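/- Let $n \ge 1$ and let $U_n$ be a random matrix distributed according to the normalized Haar measure on the unitary group $U(n)$. Let $Z_n(X) = \det(\mathrm{Id} - U_n^{-1} X)$ for $X \in \mathbb{C}$, and let $$\xi_n(z) = \frac{Z_n(e^{2 i \pi z/n})}{Z_n(1)}, \qquad z \in \mathbb{C},$$ which is well defined almost surely, since almost surely $1$ is not an eigenvalue of $U_n$. (1) Let $(z_1, \dots, z_k) \in (\mathbb{C} \setminus \mathbb{R})^k$ and $(z'_1, \dots, z'_k) \in \mathbb{C}^k$ be such that for all $1 \le i, j \le k$, $z_i - z'_j$ is not an integer multiple of $n$. Then $\prod_{j=1}^k \frac{\xi_n(z'_j)}{\xi_n(z_j)}$ is integrable and $$\det\left( \frac{1}{e^{2 i \pi z_i/n} - e^{2 i \pi z'_j/n}} \right)_{i,j=1}^k \mathbb{E}\left( \prod_{j=1}^k \frac{\xi_n(z'_j)}{\xi_n(z_j)} \right) = \det\left( \frac{1}{e^{2 i \pi z_i/n} - e^{2 i \pi z'_j/n}}\, \mathbb{E}\left( \frac{\xi_n(z'_j)}{\xi_n(z_i)} \right) \right)_{i,j=1}^k .$$ (2) For all $z \in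 \mathbb{C} \setminus \mathbb{R}$ and $z' \in \mathbb{C}$, the ratio $\frac{\xi_n(z')}{\xi_n(z)}$ is integrable and $$\mathbb{E}\left( \frac{\xi_n(z')}{\xi_n(z)} \right) = \begin{cases} 1 & \text{if } \operatorname{Im}(z) > 0, \\ e^{2 i \pi (z' - z)} & \text{if } \operatorname{Im}(z) < 0. \end{cases}$$ -/

import Mathlib

open MeasureTheory ProbabilityTheory

noncomputable section

namespace CUE

/-- The unitary group `U(n)`. -/
abbrev U (n : ℕ) : Type := Matrix.unitaryGroup (Fin n) ℂ

instance instMeasurableSpaceU (n : ℕ) : MeasurableSpace (U n) := borel (U n)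

instance instBorelSpaceU (n : ℕ) : BorelSpace (U n) := ⟨rfl⟩

instance instCompactSpaceU (n : ℕ) : CompactSpace (U n) := by
  have hK : IsCompact (Set.univ.pi fun _ : Fin n => Set.univ.pi fun _ : Fin n =>
      Metric.closedBall (0 : ℂ) 1) :=
    isCompact_univ_pi fun _ => isCompact_univ_pi fun _ => isCompact_closedBall _ _
  have hc : IsClosed ((Matrix.unitaryGroup (Fin n) ℂ : Set (Matrix (Fin n) (Fin n) ℂ))) := by
    have h : (Matrix.unitaryGroup (Fin n) ℂ : Set (Matrix (Fin n) (Fin n) ℂ)) =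
        {A | A * star A = 1} := by
      ext A
      exact Matrix.mem_unitaryGroup_iff
    rw [h]
    exact isClosed_eq (by fun_prop) continuous_const
  refine isCompact_iff_compactSpace.mp (hK.of_isClosed_subset hc ?_)
  intro A hA i _ j _
  simpa using entry_norm_bound_of_unitary hA i j

/-- The normalized Haar measure on `U(n)`. -/
def haar (n : ℕ) : Measure (U n) := Measure.haarMeasure ⊤

/-- The characteristic polynomial `Z(X) = det(Id - u⁻¹ X)` of a unitary matrix `u`. -/
def Z {n : ℕ} (u : U n) (X : ℂ) : ℂ :=
  Matrix.det (1 - X • ((u⁻¹ : U n) : Matrix (Fin n) (Fin n) ℂ))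

/-- The rescaled ratio `ξ(z) = Z(e^{2iπz/n}) / Z(1)`.  It is meaningful when `1` is not an eigenvalue
of `u`, which holds almost surely under Haar measure. -/
def xi {n : ℕ} (u : U n) (z : ℂ) : ℂ :=
  Z u (Complex.exp (2 * Complex.I * Real.pi * z / n)) / Z u 1

end CUE

end

/-! ### Haar invariance under scalar rotations -/

open MeasureTheory ProbabilityTheory

namespace CUE

/-! Since Z(X) = det(u)⁻¹ det(u - X), the factors Z(1) cancel almost surely, and the product of
ratios is det b(u) / det a(u) with b = ∏ (X - β_j), a = ∏ (X - α_j), β_j = e^{2iπz'_j/n} and α_j =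
e^{2iπz_j/n}. As |α_j| ≠ 1, this is a continuous function on a compact group, hence integrable.

The heart is the Heine–Szegő formula: E det f(u) is the n × n Toeplitz determinant of the Fourier
coefficients of f. It is derived from Haar invariance alone, without the density of the eigenvalues.
Let M(γ) = E[det(u)^{-r} ∏_{j≤m} det(γ_j - u)], a symmetric polynomial, let Δ be the Vandermonde
determinant and θ_i = X_i ∂_i. Invariance under complex reflections (`integral_hform`) gives the
first two moments of the resolvents, and these make ΔM an eigenvector of ∑ θ_i and of ∑_{i≠j} θ_i
θ_j. Both operators are diagonal on monomials, so every exponent vector of ΔM has a prescribed sum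
and sum of squares. Its entries are distinct by antisymmetry and less than n + m by degree; a
convexity argument (`exists_perm_of_sums`) leaves only the complement of [r, r + n). Hence ΔM is a
multiple of one alternant, which is up to sign Δ times a Toeplitz determinant
(`exists_vdm_mul_det_eq`), and one test polynomial fixes the constant (`integral_det_aeval_monic`).
Truncated geometric series for 1/(X - α_j) carry the formula from Laurent polynomials to b/a
(`integral_ratio_eq_det`).

What remains is linear algebra on polynomials of degree < k + n (`cauchy_det_mul_integral_ratio`).
The functionals "evaluate at β_j" and "q-th Fourier coefficient of P/a" are applied to two bases.
The basis X^c, X^p b yields Vandermonde times the Toeplitz determinant of b/a; the basis a/(X -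
α_c), X^p a yields, after a Schur complement, the determinant with entries E_{jc}/(β_j - α_c), where
E_{jc} is 1 or (β_j/α_c)^n according to whether |α_c| < 1 or not. The case k = 1 identifies E_{jc}
as the expectation of a single ratio. -/

instance instIsProbabilityMeasureHaar (n : ℕ) : IsProbabilityMeasure (haar n) :=
  ⟨by simpa [haar] using Measure.haarMeasure_self (K₀ := (⊤ : TopologicalSpace.PositiveCompacts (U n)))⟩

instance instIsHaarMeasureHaar (n : ℕ) : (haar n).IsHaarMeasure := by
  unfold haar; infer_instance

theorem integrable_haar {n : ℕ} {f : U n → ℂ} (hf : Continuous f) : Integrable f (haar n) :=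
  hf.integrable_of_hasCompactSupport (HasCompactSupport.of_compactSpace f)

theorem integral_haar_mul_left {n : ℕ} (f : U n → ℂ) (g : U n) :
    ∫ u, f (g * u) ∂haar n = ∫ u, f u ∂haar n :=
  integral_mul_left_eq_self f g

theorem infinite_unit_norm : {z : ℂ | ‖z‖ = 1}.Infinite := by
  have h : Set.InjOn (fun t : ℝ => Complex.exp (t * Complex.I)) (Set.Ioo 0 1) := by
    intro s hs t ht hst
    rw [Complex.exp_eq_exp_iff_exists_int] at hst
    obtain ⟨m, hm⟩ := hst
    have hm' := congrArg Complex.im hm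
    simp at hm'
    have h1 : |(m : ℝ) * (2 * Real.pi)| < 1 := by
      rw [show (m : ℝ) * (2 * Real.pi) = s - t by linarith, abs_lt]
      constructor <;> linarith [hs.1, hs.2, ht.1, ht.2]
    have hm0 : m = 0 := by
      by_contra h0
      have : (1 : ℝ) ≤ |(m : ℝ)| := by exact_mod_cast Int.one_le_abs h0
      rw [abs_mul, abs_of_pos (by positivity : (0 : ℝ) < 2 * Real.pi)] at h1
      nlinarith [Real.pi_gt_three]
    simp [hm0] at hm'
    linarith
  refine ((Set.Ioo_infinite (zero_lt_one' ℝ)).image h).mono ?_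
  rintro _ ⟨t, -, rfl⟩
  exact Complex.norm_exp_ofReal_mul_I t

/-- The scalar unitary matrix `ζ • 1`. -/
noncomputable def scalarU (n : ℕ) (ζ : ℂ) (h : ‖ζ‖ = 1) : U n :=
  ⟨ζ • 1, by
    rw [Matrix.mem_unitaryGroup_iff, star_smul, star_one, smul_mul_smul_comm, mul_one,
      show ζ * star ζ = 1 by simp [Complex.mul_conj, Complex.normSq_eq_norm_sq, h], one_smul]⟩

theorem coe_scalarU_mul {n : ℕ} {ζ : ℂ} (h : ‖ζ‖ = 1) (u : U n) :
    ((scalarU n ζ h * u : U n) : Matrix (Fin n) (Fin n) ℂ) = ζ • (u : Matrix (Fin n) (Fin n) ℂ) := by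
  simp [scalarU]

theorem continuous_coeU {n : ℕ} : Continuous fun u : U n => (u : Matrix (Fin n) (Fin n) ℂ) :=
  continuous_subtype_val

theorem continuous_det_sub {n : ℕ} (t : ℂ) :
    Continuous fun u : U n => (t • (1 : Matrix (Fin n) (Fin n) ℂ) - u.1).det :=
  (continuous_const.sub continuous_coeU).matrix_det

/-- By rotation, every point of the unit circle is an eigenvalue with the same probability, and a
matrix has at most n eigenvalues, so that probability is zero. -/
theorem haar_det_sub_eq_zero {n : ℕ} :
    haar n {u | (1 - (u : Matrix (Fin n) (Fin n) ℂ)).det = 0} = 0 := by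
  set A : ℂ → Set (U n) := fun t => {u | (t • (1 : Matrix (Fin n) (Fin n) ℂ) - u.1).det = 0}
  have hA : ∀ t, MeasurableSet (A t) := fun t =>
    (isClosed_eq (continuous_det_sub t) continuous_const).measurableSet
  have hrot : ∀ t : ℂ, ‖t‖ = 1 → haar n (A t) = haar n (A 1) := by
    intro t ht
    have ht0 : t ≠ 0 := by rintro rfl; simp at ht
    rw [← measure_preimage_mul (haar n) (scalarU n t ht) (A t)]
    congr 1
    ext u
    simp only [A, Set.mem_preimage, Set.mem_ofPred_eq, coe_scalarU_mul, ← smul_sub, one_smul]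
    simp [ht0]
  -- Count eigenvalues among N distinct points of the circle and take expectations.
  have key : ∀ N : ℕ, (N : ENNReal) * haar n (A 1) ≤ n := by
    intro N
    obtain ⟨T, hT, hTc⟩ := infinite_unit_norm.exists_subset_card_eq N
    calc (N : ENNReal) * haar n (A 1) = ∑ t ∈ T, haar n (A t) := by
          rw [Finset.sum_congr rfl fun t ht => hrot t (hT ht), Finset.sum_const, hTc, nsmul_eq_mul]
      _ = ∫⁻ u, ∑ t ∈ T, (A t).indicator 1 u ∂haar n := by
          rw [lintegral_finsetSum _ fun t _ => measurable_one.indicator (hA t)]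
          exact Finset.sum_congr rfl fun t _ => (lintegral_indicator_one (hA t)).symm
      _ ≤ ∫⁻ _, (n : ENNReal) ∂haar n := by
          refine lintegral_mono fun u => ?_
          classical
          have h1 : ∑ t ∈ T, (A t).indicator (1 : U n → ENNReal) u
              = ((T.filter fun t => u ∈ A t).card : ENNReal) := by
            rw [Finset.card_filter]
            push_cast
            exact Finset.sum_congr rfl fun t _ => by simp [Set.indicator_apply]
          rw [h1]
          have hne : u.1.charpoly ≠ 0 := (Matrix.charpoly_monic _).ne_zero
          have hsub : (T.filter fun t => u ∈ A t) ⊆ u.1.charpoly.roots.toFinset := by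
            intro t ht
            have := (Finset.mem_filter.1 ht).2
            simp only [Multiset.mem_toFinset, Polynomial.mem_roots hne, Polynomial.IsRoot.def,
              Matrix.eval_charpoly]
            simpa [A, Matrix.smul_one_eq_diagonal] using this
          have := (Finset.card_le_card hsub).trans ((Multiset.toFinset_card_le _).trans
            (Polynomial.card_roots' _))
          rw [Matrix.charpoly_natDegree_eq_dim, Fintype.card_fin] at this
          exact Nat.cast_le.2 this
      _ = n := by simp
  have h0 : haar n (A 1) = 0 := by
    by_contra h
    obtain ⟨N, hN⟩ := ENNReal.exists_nat_mul_gt h (ENNReal.natCast_ne_top n)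
    exact absurd (key N) (not_le.2 hN)
  simpa [A] using h0

/-- Lagrange interpolation at 0, …, d writes each coefficient as a fixed linear combination of
values. -/
theorem continuous_coeff_of_eval {Y : Type*} [TopologicalSpace Y] {P : Y → Polynomial ℂ} {d : ℕ}
    (hd : ∀ y, (P y).natDegree ≤ d) (hP : ∀ x, Continuous fun y => (P y).eval x) (i : ℕ) :
    Continuous fun y => (P y).coeff i := by
  have hinj : Set.InjOn (fun j : ℕ => (j : ℂ)) (Finset.range (d + 1)) :=
    fun a _ b _ h => Nat.cast_injective h
  have h : ∀ y, (P y).coeff i = ∑ j ∈ Finset.range (d + 1), (P y).eval (j : ℂ) *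
      (Lagrange.basis (Finset.range (d + 1)) (fun j : ℕ => (j : ℂ)) j).coeff i := by
    intro y
    have hdeg : (P y).degree < (Finset.range (d + 1)).card := by
      rw [Finset.card_range]
      exact (Polynomial.degree_le_natDegree).trans_lt
        (by exact_mod_cast Nat.lt_succ_of_le (hd y))
    conv_lhs => rw [Lagrange.eq_interpolate hinj hdeg]
    simp [Lagrange.interpolate_apply]
  simp_rw [h]
  exact continuous_finsetSum _ fun j _ => (hP _).mul continuous_const

/-- The polynomial whose coefficients are the expected coefficients of a random polynomial. -/
noncomputable def meanPoly {n : ℕ} (d : ℕ) (P : U n → Polynomial ℂ) : Polynomial ℂ :=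
  ∑ i ∈ Finset.range (d + 1), Polynomial.monomial i (∫ u, (P u).coeff i ∂haar n)

theorem coeff_meanPoly {n d : ℕ} {P : U n → Polynomial ℂ} (hd : ∀ u, (P u).natDegree ≤ d) (i : ℕ) :
    (meanPoly d P).coeff i = ∫ u, (P u).coeff i ∂haar n := by
  simp only [meanPoly, Polynomial.finsetSum_coeff, Polynomial.coeff_monomial]
  rw [Finset.sum_ite_eq' (Finset.range (d + 1)) i]
  split_ifs with h
  · rfl
  · have : ∀ u, (P u).coeff i = 0 := fun u =>
      Polynomial.coeff_eq_zero_of_natDegree_lt ((hd u).trans_lt (by simpa using h))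
    simp [this]

theorem eval_meanPoly {n d : ℕ} {P : U n → Polynomial ℂ} (hd : ∀ u, (P u).natDegree ≤ d)
    (hP : ∀ x, Continuous fun u => (P u).eval x) (x : ℂ) :
    (meanPoly d P).eval x = ∫ u, (P u).eval x ∂haar n := by
  have h : ∀ u, (P u).eval x = ∑ i ∈ Finset.range (d + 1), (P u).coeff i * x ^ i := fun u =>
    Polynomial.eval_eq_sum_range' (Nat.lt_succ_of_le (hd u)) x
  simp_rw [h]
  have hi : ∀ i ∈ Finset.range (d + 1), Integrable (fun u => (P u).coeff i * x ^ i) (haar n) :=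
    fun i _ => integrable_haar ((continuous_coeff_of_eval hd hP i).mul continuous_const)
  rw [integral_finsetSum _ hi]
  simp [meanPoly, Polynomial.eval_finsetSum, integral_mul_const]

/-- The polynomial x ↦ E det(1 + x u^s) is constant on the unit circle by rotation invariance, hence
constant, and it is 1 at x = 0. This later serves as the test case that fixes a normalization. -/
theorem integral_det_one_add_pow {n : ℕ} {s : ℕ} (hs : s ≠ 0) :
    ∫ u : U n, (1 + (u : Matrix (Fin n) (Fin n) ℂ) ^ s).det ∂haar n = 1 := by
  set P : U n → Polynomial ℂ := fun u => Matrix.det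
    ((Polynomial.X : Polynomial ℂ) • (u.1 ^ s).map Polynomial.C
      + (1 : Matrix (Fin n) (Fin n) ℂ).map Polynomial.C)
  have hd : ∀ u, (P u).natDegree ≤ n := fun u => by
    have h := Polynomial.natDegree_det_X_add_C_le (u.1 ^ s) (1 : Matrix (Fin n) (Fin n) ℂ)
    rwa [Fintype.card_fin] at h
  have hev : ∀ x u, (P u).eval x = (1 + x • u.1 ^ s).det := by
    intro x u
    rw [← Polynomial.coe_evalRingHom, RingHom.map_det]
    congr 1
    ext i j
    by_cases hij : i = j <;> simp [add_comm, hij] <;> exact mul_comm _ _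
  have hP : ∀ x, Continuous fun u => (P u).eval x := by
    intro x
    simp_rw [hev]
    exact (continuous_const.add ((continuous_coeU.pow s).const_smul x)).matrix_det
  have h1 : ∀ x : ℂ, ‖x‖ = 1 →
      (meanPoly n P).eval x = (Polynomial.C ((meanPoly n P).eval 1)).eval x := by
    intro x hx
    -- Rotating u by an s-th root of x multiplies u^s by x.
    obtain ⟨ζ, hζ⟩ := IsAlgClosed.exists_pow_nat_eq x (Nat.pos_of_ne_zero hs)
    have hζ1 : ‖ζ‖ = 1 := by
      rw [← hζ, norm_pow] at hx
      exact (pow_eq_one_iff_of_nonneg (norm_nonneg _) hs).1 hx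
    rw [Polynomial.eval_C, eval_meanPoly hd hP, eval_meanPoly hd hP]
    simp_rw [hev, one_smul]
    rw [← integral_haar_mul_left (fun u => (1 + u.1 ^ s).det) (scalarU n ζ hζ1)]
    simp_rw [coe_scalarU_mul, smul_pow, hζ]
  have h2 := Polynomial.eq_of_infinite_eval_eq _ _ (infinite_unit_norm.mono fun x hx => h1 x hx)
  have h3 := congrArg (Polynomial.eval 0) h2
  rw [Polynomial.eval_C, eval_meanPoly hd hP, eval_meanPoly hd hP] at h3
  simp_rw [hev] at h3
  simpa using h3.symm

end CUE

/-! ### Complex reflections and moments of resolvents -/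

open MeasureTheory ProbabilityTheory

namespace CUE

open Matrix

-- A kernel vector v would satisfy u v = γ v, and u preserves v* v, forcing |γ| = 1.
open scoped ComplexOrder in
theorem det_smul_one_sub_ne_zero {n : ℕ} (u : U n) {γ : ℂ} (hγ : ‖γ‖ ≠ 1) :
    (γ • (1 : Matrix (Fin n) (Fin n) ℂ) - u.1).det ≠ 0 := by
  intro h
  obtain ⟨v, hv, hv0⟩ := Matrix.exists_mulVec_eq_zero_iff.2 h
  rw [Matrix.sub_mulVec, Matrix.smul_mulVec, Matrix.one_mulVec, sub_eq_zero] at hv0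
  have h1 : star (u.1 *ᵥ v) ⬝ᵥ (u.1 *ᵥ v) = star v ⬝ᵥ v := by
    rw [Matrix.star_mulVec, Matrix.dotProduct_mulVec, Matrix.vecMul_vecMul,
      ← Matrix.star_eq_conjTranspose, Matrix.UnitaryGroup.star_mul_self, Matrix.vecMul_one]
  rw [← hv0, star_smul, smul_dotProduct, dotProduct_smul, smul_smul, smul_eq_mul] at h1
  have h2 : star v ⬝ᵥ v ≠ 0 := by
    rwa [Ne, dotProduct_star_self_eq_zero]
  have h3 : star γ * γ = 1 := mul_right_cancel₀ h2 (by rw [h1, one_mul])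
  have h4 : ‖γ‖ * ‖γ‖ = 1 := by simpa using congrArg norm h3
  exact hγ (by nlinarith [norm_nonneg γ])

theorem det_coeU_ne_zero {n : ℕ} (u : U n) : u.1.det ≠ 0 :=
  (Matrix.UnitaryGroup.det_isUnit u).ne_zero

/-- The complex reflection `1 + ε v v*`. -/
noncomputable def reflU {n : ℕ} (v : Fin n → ℂ) (ε : ℂ)
    (h : ε + star ε + ε * star ε * (star v ⬝ᵥ v) = 0) : U n :=
  ⟨1 + ε • vecMulVec v (star v), by
    rw [Matrix.mem_unitaryGroup_iff, star_add, star_smul, star_one, Matrix.star_eq_conjTranspose,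
      conjTranspose_vecMulVec, star_star, add_mul, mul_add, mul_add, smul_mul_smul_comm,
      vecMulVec_mul_vecMulVec, one_mul, one_mul, mul_one, vecMulVec_smul, smul_smul, add_assoc,
      ← add_smul, ← add_smul,
      show star ε + (ε + ε * star ε * (star v ⬝ᵥ v)) = 0 by rw [← h]; ring, zero_smul, add_zero]⟩

/-- The quadratic form `v* R v`. -/
noncomputable def hform {n : ℕ} (R : Matrix (Fin n) (Fin n) ℂ) (v : Fin n → ℂ) : ℂ :=
  star v ⬝ᵥ (R *ᵥ v)

/-- The matrix `u (γ - u)⁻¹`. -/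
noncomputable def resolv {n : ℕ} (γ : ℂ) (u : U n) : Matrix (Fin n) (Fin n) ℂ :=
  u.1 * (γ • (1 : Matrix (Fin n) (Fin n) ℂ) - u.1)⁻¹

theorem det_reflU {n : ℕ} {v : Fin n → ℂ} {ε : ℂ}
    (h : ε + star ε + ε * star ε * (star v ⬝ᵥ v) = 0) :
    (reflU v ε h).1.det = 1 + ε * (star v ⬝ᵥ v) := by
  simp only [reflU]
  rw [← smul_vecMulVec, vecMulVec_eq Unit, det_one_add_replicateCol_mul_replicateRow,
    dotProduct_smul, smul_eq_mul]

/-- Multiplication by a reflection is a rank-one perturbation of u, so the matrix determinant lemma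
applies. -/
theorem det_sub_reflU_mul {n : ℕ} {v : Fin n → ℂ} {ε γ : ℂ} (hγ : ‖γ‖ ≠ 1)
    (h : ε + star ε + ε * star ε * (star v ⬝ᵥ v) = 0) (u : U n) :
    (γ • (1 : Matrix (Fin n) (Fin n) ℂ) - (reflU v ε h * u : U n).1).det
      = (γ • (1 : Matrix (Fin n) (Fin n) ℂ) - u.1).det * (1 - ε * hform (resolv γ u) v) := by
  have h1 : γ • (1 : Matrix (Fin n) (Fin n) ℂ) - (reflU v ε h * u : U n).1
      = (γ • (1 : Matrix (Fin n) (Fin n) ℂ) - u.1)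
        + replicateCol Unit (-(ε • v)) * replicateRow Unit (star v ᵥ* u.1) := by
    rw [← vecMulVec_eq, Matrix.UnitaryGroup.mul_val, reflU, add_mul, one_mul, ← smul_vecMulVec,
      vecMulVec_mul, neg_vecMulVec]
    abel
  rw [h1, det_add_replicateCol_mul_replicateRow (det_smul_one_sub_ne_zero u hγ).isUnit]
  congr 1
  rw [det_unique]
  simp only [Matrix.add_apply, Matrix.one_apply_eq, sub_eq_add_neg]
  congr 1
  rw [Matrix.mul_assoc]
  change (star v ᵥ* u.1) ⬝ᵥ ((γ • (1 : Matrix (Fin n) (Fin n) ℂ) - u.1)⁻¹ *ᵥ (-(ε • v))) = _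
  rw [mulVec_neg, mulVec_smul, dotProduct_neg, dotProduct_smul, smul_eq_mul, hform, resolv,
    ← Matrix.dotProduct_mulVec, Matrix.mulVec_mulVec]

theorem continuous_resolv {n : ℕ} {γ : ℂ} (hγ : ‖γ‖ ≠ 1) :
    Continuous fun u : U n => resolv γ u := by
  have h : ∀ u : U n, resolv γ u = ((γ • (1 : Matrix (Fin n) (Fin n) ℂ) - u.1).det)⁻¹ •
      (u.1 * (γ • (1 : Matrix (Fin n) (Fin n) ℂ) - u.1).adjugate) := by
    intro u
    rw [resolv, Matrix.inv_def, Ring.inverse_eq_inv', Matrix.mul_smul]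
  simp_rw [h]
  refine ((continuous_det_sub γ).inv₀ fun u => det_smul_one_sub_ne_zero u hγ).smul ?_
  exact continuous_coeU.matrix_mul (continuous_const.sub continuous_coeU).matrix_adjugate

theorem continuous_hform {n : ℕ} {γ : ℂ} (hγ : ‖γ‖ ≠ 1) (v : Fin n → ℂ) :
    Continuous fun u : U n => hform (resolv γ u) v :=
  continuous_const.dotProduct ((continuous_resolv hγ).matrix_mulVec continuous_const)

/-- The function `det(u)^{-r} ∏ det(γ_j - u)`. -/
noncomputable def detProd {n m : ℕ} (r : ℕ) (γ : Fin m → ℂ) (u : U n) : ℂ :=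
  (u.1.det ^ r)⁻¹ * ∏ j, (γ j • (1 : Matrix (Fin n) (Fin n) ℂ) - u.1).det

theorem continuous_detProd {n m : ℕ} (r : ℕ) (γ : Fin m → ℂ) :
    Continuous (detProd (n := n) r γ) := by
  refine Continuous.mul ?_ (continuous_finsetProd _ fun j _ => continuous_det_sub _)
  exact ((continuous_coeU.matrix_det).pow r).inv₀ fun u => pow_ne_zero _ (det_coeU_ne_zero u)

/-- Newton's identities for the first two elementary symmetric functions. -/
theorem coeff_prod_one_sub {ι : Type*} (s : Finset ι) (q : ι → ℂ) :
    (∏ j ∈ s, (1 - Polynomial.C (q j) * Polynomial.X)).coeff 0 = 1 ∧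
    (∏ j ∈ s, (1 - Polynomial.C (q j) * Polynomial.X)).coeff 1 = - ∑ j ∈ s, q j ∧
    2 * (∏ j ∈ s, (1 - Polynomial.C (q j) * Polynomial.X)).coeff 2
      = (∑ j ∈ s, q j) ^ 2 - ∑ j ∈ s, q j ^ 2 := by
  classical
  induction s using Finset.induction_on with
  | empty => simp [Polynomial.coeff_one]
  | insert a s ha ih =>
    obtain ⟨h0, h1, h2⟩ := ih
    rw [Finset.prod_insert ha, Finset.sum_insert ha, Finset.sum_insert ha]
    set p := ∏ j ∈ s, (1 - Polynomial.C (q j) * Polynomial.X)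
    have e : (1 - Polynomial.C (q a) * Polynomial.X) * p
        = p - Polynomial.C (q a) * (Polynomial.X * p) := by ring
    rw [e]
    simp only [Polynomial.coeff_sub, Polynomial.coeff_C_mul, Polynomial.coeff_X_mul_zero,
      Polynomial.coeff_X_mul (n := 0), Polynomial.coeff_X_mul (n := 1), h0, h1]
    refine ⟨by ring, by ring, ?_⟩
    linear_combination h2

theorem detProd_reflU_mul {n m : ℕ} (r : ℕ) {γ : Fin m → ℂ} (hγ : ∀ j, ‖γ j‖ ≠ 1) {v : Fin n → ℂ}
    {ε : ℂ} (h : ε + star ε + ε * star ε * (star v ⬝ᵥ v) = 0) (u : U n) :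
    detProd r γ u * ∏ j, (1 - ε * hform (resolv (γ j) u) v)
      = (1 + ε * (star v ⬝ᵥ v)) ^ r * detProd r γ (reflU v ε h * u) := by
  have h0 : 1 + ε * (star v ⬝ᵥ v) ≠ 0 := by
    rw [← det_reflU h]; exact det_coeU_ne_zero _
  simp only [detProd]
  rw [Finset.prod_congr rfl fun j _ => det_sub_reflU_mul (hγ j) h u, Finset.prod_mul_distrib,
    Matrix.UnitaryGroup.mul_val, det_mul, det_reflU, mul_pow, mul_inv]
  field_simp

-- Replacing u by its product with a reflection does not change E of `detProd`. This gives E[detProd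
-- · ∏ (1 - ε h_j)] = (1 + ε c)^r E[detProd], where h_j is the quadratic form of the j-th resolvent
-- at v and c = v* v. Both sides are polynomials in ε that agree on infinitely many points; the
-- coefficients of ε and ε² are the two claims.
open scoped ComplexOrder in
theorem integral_hform {n m : ℕ} (r : ℕ) {γ : Fin m → ℂ} (hγ : ∀ j, ‖γ j‖ ≠ 1) (v : Fin n → ℂ) :
    ∫ u, detProd r γ u * ∑ j, hform (resolv (γ j) u) v ∂haar n
        = -(r * (star v ⬝ᵥ v)) * ∫ u : U n, detProd r γ u ∂haar n ∧
    ∫ u, detProd r γ u * ((∑ j, hform (resolv (γ j) u) v) ^ 2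
          - ∑ j, hform (resolv (γ j) u) v ^ 2) ∂haar n
        = (r * (r - 1) * (star v ⬝ᵥ v) ^ 2) * ∫ u : U n, detProd r γ u ∂haar n := by
  by_cases hv : v = 0
  · subst hv; simp [hform]
  set c : ℂ := star v ⬝ᵥ v with hc
  have hc0 : c ≠ 0 := by rwa [Ne, dotProduct_star_self_eq_zero]
  have hcs : star c = c := by
    simp only [hc, dotProduct, star_sum, star_mul, Pi.star_apply, star_star]
  set K : ℂ := ∫ u : U n, detProd r γ u ∂haar n with hK
  set Q : U n → Polynomial ℂ := fun u =>
    ∏ j, (1 - Polynomial.C (hform (resolv (γ j) u) v) * Polynomial.X) with hQ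
  set P : U n → Polynomial ℂ := fun u => Polynomial.C (detProd r γ u) * Q u with hP
  have hd : ∀ u, (P u).natDegree ≤ m := by
    intro u
    refine (Polynomial.natDegree_C_mul_le _ _).trans ((Polynomial.natDegree_prod_le _ _).trans ?_)
    refine (Finset.sum_le_card_nsmul _ _ 1 fun j _ => ?_).trans (by simp)
    compute_degree
  have hev : ∀ x u, (P u).eval x = detProd r γ u * ∏ j, (1 - x * hform (resolv (γ j) u) v) := by
    intro x u
    simp only [P, Q, Polynomial.eval_mul, Polynomial.eval_C, Polynomial.eval_prod,
      Polynomial.eval_sub, Polynomial.eval_one, Polynomial.eval_X]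
    congr 1
    exact Finset.prod_congr rfl fun j _ => by rw [mul_comm]
  have hcont : ∀ x, Continuous fun u => (P u).eval x := by
    intro x
    simp_rw [hev]
    exact (continuous_detProd r γ).mul (continuous_finsetProd _ fun j _ =>
      continuous_const.sub (continuous_const.mul (continuous_hform (hγ j) v)))
  set T : Polynomial ℂ :=
    Polynomial.C K * ∏ _j ∈ Finset.range r, (1 - Polynomial.C (-c) * Polynomial.X) with hT
  have hmean : meanPoly m P = T := by
    -- The reflection is unitary exactly when |1 + ε c| = 1, that is ε = (ζ - 1)/c with |ζ| = 1: an
    -- infinite set of admissible ε.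
    refine Polynomial.eq_of_infinite_eval_eq _ _ ((infinite_unit_norm.image
      (f := fun ζ => (ζ - 1) / c) fun a _ b _ hab => ?_).mono ?_)
    · simpa [div_left_inj' hc0] using hab
    · rintro _ ⟨ζ, hζ, rfl⟩
      have hζ' : ζ * star ζ = 1 := by
        simp [Complex.mul_conj, Complex.normSq_eq_norm_sq, (show ‖ζ‖ = 1 from hζ)]
      have hε : (ζ - 1) / c + star ((ζ - 1) / c) + (ζ - 1) / c * star ((ζ - 1) / c) * c = 0 := by
        rw [star_div₀, star_sub, star_one, hcs]
        field_simp
        linear_combination hζ'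
      change (meanPoly m P).eval _ = T.eval _
      rw [eval_meanPoly hd hcont]
      simp_rw [hev, detProd_reflU_mul r hγ hε]
      rw [integral_const_mul, integral_haar_mul_left (detProd r γ)]
      simp only [hT, Polynomial.eval_mul, Polynomial.eval_C, Polynomial.eval_pow,
        Polynomial.eval_sub, Polynomial.eval_one, Polynomial.eval_X, Finset.prod_const,
        Finset.card_range]
      rw [← hc, ← hK]
      field_simp
      ring
  have hc1 := congrArg (Polynomial.coeff · 1) hmean
  have hc2 := congrArg (Polynomial.coeff · 2) hmean
  obtain ⟨-, hT1, hT2⟩ := coeff_prod_one_sub (Finset.range r) fun _ => -c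
  simp only [coeff_meanPoly hd] at hc1 hc2
  simp only [hP, hT, Polynomial.coeff_C_mul] at hc1 hc2
  simp only [Finset.sum_const, Finset.card_range, nsmul_eq_mul] at hT1 hT2
  constructor
  · have : ∀ u, detProd r γ u * ∑ j, hform (resolv (γ j) u) v
        = -(detProd r γ u * (Q u).coeff 1) := by
      intro u
      rw [hQ, (coeff_prod_one_sub Finset.univ _).2.1]; ring
    simp_rw [this]
    rw [integral_neg, hc1, hT1]; ring
  · have : ∀ u, detProd r γ u * ((∑ j, hform (resolv (γ j) u) v) ^ 2
        - ∑ j, hform (resolv (γ j) u) v ^ 2) = 2 * (detProd r γ u * (Q u).coeff 2) := by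
      intro u
      rw [hQ, ← (coeff_prod_one_sub Finset.univ _).2.2]; ring
    simp_rw [this]
    rw [integral_const_mul, hc2]
    linear_combination K * hT2

theorem hform_sum {n : ℕ} {ι : Type*} (s : Finset ι) (R : ι → Matrix (Fin n) (Fin n) ℂ)
    (v : Fin n → ℂ) : hform (∑ j ∈ s, R j) v = ∑ j ∈ s, hform (R j) v := by
  simp [hform, Matrix.sum_mulVec, dotProduct_sum]

theorem hform_single {n : ℕ} (R : Matrix (Fin n) (Fin n) ℂ) (a : Fin n) :
    hform R (Pi.single a 1) = R a a := by
  simp [hform]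

theorem hform_single_add {n : ℕ} (R : Matrix (Fin n) (Fin n) ℂ) (a b : Fin n) (z : ℂ) :
    hform R (Pi.single a 1 + z • Pi.single b 1)
      = R a a + z * R a b + star z * R b a + star z * z * R b b := by
  simp [hform, mulVec_add, mulVec_smul, add_dotProduct, dotProduct_add,
    smul_dotProduct, dotProduct_smul]
  ring

/-- The quadratic trace `(tr R)² + tr R²`. -/
noncomputable def quadTrace {n : ℕ} (R : Matrix (Fin n) (Fin n) ℂ) : ℂ :=
  R.trace ^ 2 + (R * R).trace

/-- Polarization: averaging over the fourth roots of unity i^k keeps from the squared form only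
(R_aa + R_bb)² + 2 R_ab R_ba. Subtracting the diagonal squares leaves (tr R)² + tr R². This turns
information on h(v)² for all v into information on traces. -/
theorem quadTrace_eq {n : ℕ} (R : Matrix (Fin n) (Fin n) ℂ) :
    quadTrace R = (1 / 8) * (∑ a : Fin n, ∑ b : Fin n, ∑ k : Fin 4,
        hform R (Pi.single a 1 + (Complex.I ^ (k : ℕ)) • Pi.single b 1) ^ 2)
      - n * ∑ a : Fin n, hform R (Pi.single a 1) ^ 2 := by
  have h1 : ∀ a b : Fin n, ∑ k : Fin 4,
      hform R (Pi.single a 1 + (Complex.I ^ (k : ℕ)) • Pi.single b 1) ^ 2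
      = 4 * ((R a a + R b b) ^ 2 + 2 * (R a b * R b a)) := by
    intro a b
    have hI2 := Complex.I_sq
    have hI3 : Complex.I ^ 3 = -Complex.I := by rw [pow_succ, hI2]; ring
    simp only [hform_single_add, Fin.sum_univ_four, Fin.val_zero, Fin.val_one, Fin.val_two,
      show ((3 : Fin 4) : ℕ) = 3 from rfl, pow_zero, pow_one, hI2, hI3]
    simp only [star_one, star_neg, Complex.star_def, Complex.conj_I]
    ring_nf
    simp only [hI2, Complex.I_pow_four]
    ring
  simp_rw [h1, hform_single]
  have h2 : (R * R).trace = ∑ a, ∑ b, R a b * R b a := by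
    simp [Matrix.trace, Matrix.mul_apply]
  have h3 : R.trace = ∑ a, R a a := rfl
  have h4 : ∑ a, ∑ b, (R a a + R b b) ^ 2 = 2 * n * (∑ a, R a a ^ 2) + 2 * R.trace ^ 2 := by
    simp only [add_sq, Finset.sum_add_distrib, Finset.sum_const, Finset.card_univ,
      Fintype.card_fin, nsmul_eq_mul, ← Finset.mul_sum, ← Finset.sum_mul, h3]
    ring
  rw [quadTrace, h2]
  simp_rw [← Finset.mul_sum, Finset.sum_add_distrib, ← Finset.mul_sum]
  rw [h4]
  ring

theorem quadTrace_one {n : ℕ} : quadTrace (1 : Matrix (Fin n) (Fin n) ℂ) = n ^ 2 + n := by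
  simp [quadTrace]

theorem integral_trace_resolv {n m : ℕ} (r : ℕ) {γ : Fin m → ℂ} (hγ : ∀ j, ‖γ j‖ ≠ 1) :
    ∫ u : U n, detProd r γ u * ∑ j, (resolv (γ j) u).trace ∂haar n
      = -(r * n) * ∫ u : U n, detProd r γ u ∂haar n := by
  have h : ∀ u : U n, detProd r γ u * ∑ j, (resolv (γ j) u).trace
      = ∑ a, detProd r γ u * ∑ j, hform (resolv (γ j) u) (Pi.single a 1) := by
    intro u
    rw [← Finset.mul_sum, Finset.sum_comm]
    simp [hform_single, Matrix.trace]
  simp_rw [h]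
  rw [integral_finsetSum]
  · simp_rw [(integral_hform r hγ _).1]
    simp
    ring
  · exact fun a _ => integrable_haar ((continuous_detProd r γ).mul
      (continuous_finsetSum _ fun j _ => continuous_hform (hγ j) _))

/-- The polarization formula is linear in the squares of the forms, and the second moment identity
replaces these squares by multiples of (v* v)², the square of the form of the identity matrix. The
value n² + n is therefore `quadTrace 1`. -/
theorem integral_quadTrace_resolv {n m : ℕ} (r : ℕ) {γ : Fin m → ℂ} (hγ : ∀ j, ‖γ j‖ ≠ 1) :
    ∫ u : U n, detProd r γ u * (quadTrace (∑ j, resolv (γ j) u)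
        - ∑ j, quadTrace (resolv (γ j) u)) ∂haar n
      = (r * (r - 1) * (n ^ 2 + n)) * ∫ u : U n, detProd r γ u ∂haar n := by
  set D : (Fin n → ℂ) → U n → ℂ := fun v u => detProd r γ u *
    ((∑ j, hform (resolv (γ j) u) v) ^ 2 - ∑ j, hform (resolv (γ j) u) v ^ 2) with hD
  have hDi : ∀ v, Integrable (D v) (haar n) := fun v => integrable_haar
    ((continuous_detProd r γ).mul (((continuous_finsetSum _ fun j _ =>
      continuous_hform (hγ j) _).pow 2).sub (continuous_finsetSum _ fun j _ =>
      (continuous_hform (hγ j) _).pow 2)))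
  -- Recognizing v* v as a quadratic form lets `quadTrace_eq` be used backwards at the end.
  have hone : ∀ v : Fin n → ℂ, star v ⬝ᵥ v = hform 1 v := fun v => by simp [hform]
  have hDint : ∀ v, ∫ u, D v u ∂haar n
      = (r * (r - 1) * ∫ u : U n, detProd r γ u ∂haar n) * hform 1 v ^ 2 := by
    intro v
    rw [← hone, hD, (integral_hform r hγ v).2]
    ring
  have h : ∀ u : U n, detProd r γ u * (quadTrace (∑ j, resolv (γ j) u)
        - ∑ j, quadTrace (resolv (γ j) u))
      = (1 / 8) * (∑ a : Fin n, ∑ b : Fin n, ∑ k : Fin 4,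
          D (Pi.single a 1 + (Complex.I ^ (k : ℕ)) • Pi.single b 1) u)
        - n * ∑ a : Fin n, D (Pi.single a 1) u := by
    intro u
    simp_rw [quadTrace_eq, hform_sum, hD]
    simp_rw [← Finset.mul_sum, Finset.sum_sub_distrib, ← Finset.mul_sum]
    rw [Finset.sum_comm (s := (Finset.univ : Finset (Fin m)))
      (t := (Finset.univ : Finset (Fin n)))]
    simp_rw [Finset.sum_comm (s := (Finset.univ : Finset (Fin m)))
      (t := (Finset.univ : Finset (Fin n)))]
    simp_rw [Finset.sum_comm (s := (Finset.univ : Finset (Fin m)))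
      (t := (Finset.univ : Finset (Fin 4)))]
    ring
  simp_rw [h]
  rw [integral_sub, integral_const_mul, integral_const_mul, integral_finsetSum,
    integral_finsetSum]
  · simp_rw [integral_finsetSum _ fun b _ => integrable_finsetSum _ fun k _ => hDi _]
    simp_rw [integral_finsetSum _ fun k _ => hDi _, hDint, ← Finset.mul_sum]
    rw [← quadTrace_one, quadTrace_eq]
    ring
  · exact fun a _ => hDi _
  · exact fun a _ => integrable_finsetSum _ fun b _ => integrable_finsetSum _ fun k _ => hDi _
  · exact (integrable_finsetSum _ fun a _ => integrable_finsetSum _ fun b _ =>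
      integrable_finsetSum _ fun k _ => hDi _).const_mul _
  · exact (integrable_finsetSum _ fun a _ => hDi _).const_mul _

end CUE

/-! ### Euler-type operators and the Vandermonde determinant -/

open MeasureTheory ProbabilityTheory

namespace CUE

open Matrix

/-- The sum over ordered pairs of distinct indices. -/
def offSum {m : ℕ} {M : Type*} [AddCommMonoid M] (F : Fin m → Fin m → M) : M :=
  ∑ i, ∑ j ∈ Finset.univ.erase i, F i j

theorem offSum_swap {m : ℕ} {M : Type*} [AddCommMonoid M] (F : Fin m → Fin m → M) :
    offSum F = offSum fun i j => F j i := by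
  unfold offSum
  rw [Finset.sum_comm' (t' := Finset.univ) (s' := fun j => Finset.univ.erase j)]
  intro x y
  simp [eq_comm]

theorem offSum_add {m : ℕ} {M : Type*} [AddCommMonoid M] (F G : Fin m → Fin m → M) :
    offSum (fun i j => F i j + G i j) = offSum F + offSum G := by
  simp [offSum, Finset.sum_add_distrib]

theorem offSum_congr {m : ℕ} {M : Type*} [AddCommMonoid M] {F G : Fin m → Fin m → M}
    (h : ∀ i j, i ≠ j → F i j = G i j) : offSum F = offSum G :=
  Finset.sum_congr rfl fun i _ => Finset.sum_congr rfl fun j hj =>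
    h i j (Finset.ne_of_mem_erase hj).symm

theorem offSum_eq_sub {m : ℕ} (F : Fin m → Fin m → ℂ) :
    offSum F = ∑ i, ∑ j, F i j - ∑ i, F i i := by
  simp [offSum, Finset.sum_erase_eq_sub]

theorem offSum_mul {m : ℕ} (f g : Fin m → ℂ) :
    offSum (fun i j => f i * g j) = (∑ i, f i) * (∑ j, g j) - ∑ i, f i * g i := by
  rw [offSum_eq_sub, Finset.sum_mul_sum]

theorem mul_offSum {m : ℕ} (c : ℂ) (F : Fin m → Fin m → ℂ) :
    c * offSum F = offSum fun i j => c * F i j := by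
  simp only [offSum, Finset.mul_sum]

/-- Here t_i stands for the trace of the i-th resolvent, ρ_ij for the trace of the product of two,
and A_i = ∑_{l≠i} γ_i/(γ_i - γ_l) for the logarithmic derivative of the Vandermonde determinant. The
hypothesis on ρ is the traced resolvent identity. It converts the awkward term ∑ A_i t_i into ∑
ρ_ij, and so produces t_i t_j + ρ_ij, the combination whose mean is known. -/
theorem offSum_symmetrize {m n : ℕ} {γ t : Fin m → ℂ} {ρ : Fin m → Fin m → ℂ} {s : ℂ}
    (hγ : Function.Injective γ)
    (hρ : ∀ i j, (γ j - γ i) * ρ i j = γ i * t i - γ j * t j)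
    (hs : ∑ i, ∑ l ∈ Finset.univ.erase i, γ i / (γ i - γ l) = s) :
    offSum (fun i j => (∑ l ∈ Finset.univ.erase j, γ j / (γ j - γ l)) * (n + t i)
        + (∑ l ∈ Finset.univ.erase i, γ i / (γ i - γ l)) * (n + t j) + (n + t i) * (n + t j))
      = 2 * n * (m - 1) * s + m * (m - 1) * n ^ 2 + (2 * s + 2 * n * (m - 1)) * ∑ i, t i
        + offSum fun i j => t i * t j + ρ i j := by
  set A : Fin m → ℂ := fun i => ∑ l ∈ Finset.univ.erase i, γ i / (γ i - γ l) with hA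
  -- Pairing (i, j) with (j, i) makes the denominators γ_i - γ_j cancel through the relation for ρ.
  have h1 : 2 * ∑ i, A i * t i = - offSum ρ := by
    have e1 : ∑ i, A i * t i = offSum fun i l => γ i * t i / (γ i - γ l) := by
      simp only [hA, offSum, Finset.sum_mul, div_mul_eq_mul_div]
    have e2 : - offSum ρ = offSum fun i j => γ i * t i / (γ i - γ j) + γ j * t j / (γ j - γ i) := by
      rw [← neg_one_mul, mul_offSum]
      refine offSum_congr fun i j hij => ?_
      have h1 : γ i - γ j ≠ 0 := sub_ne_zero.2 (hγ.ne hij)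
      have h2 : γ j - γ i ≠ 0 := sub_ne_zero.2 (hγ.ne hij.symm)
      field_simp
      linear_combination (γ j - γ i) * hρ i j
    rw [e2, offSum_add, two_mul, e1]
    congr 1
    exact offSum_swap _
  rw [offSum_add, offSum_add, offSum_add]
  have hsw : offSum (fun i j => A j * (n + t i)) = offSum (fun i j => A i * (n + t j)) :=
    offSum_swap _
  rw [hsw, offSum_mul, offSum_mul, offSum_mul, show ∑ i, A i = s from hs]
  simp only [mul_add, add_mul, Finset.sum_add_distrib, ← Finset.sum_mul, Finset.sum_const,
    Finset.card_univ, Fintype.card_fin, nsmul_eq_mul, show ∑ i, A i = s from hs,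
    ← Finset.mul_sum]
  linear_combination -h1

/-- The derivation `X_i ∂_i`. -/
noncomputable def theta {m : ℕ} (i : Fin m) :
    Derivation ℂ (MvPolynomial (Fin m) ℂ) (MvPolynomial (Fin m) ℂ) :=
  (MvPolynomial.X i : MvPolynomial (Fin m) ℂ) • MvPolynomial.pderiv i

theorem theta_X {m : ℕ} (i j : Fin m) :
    theta i (MvPolynomial.X j) = if i = j then MvPolynomial.X j else 0 := by
  rw [theta, Derivation.smul_apply, MvPolynomial.pderiv_X]
  split_ifs with h <;> simp [h, eq_comm]

theorem eval_theta_X {m : ℕ} (γ : Fin m → ℂ) (i j : Fin m) :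
    MvPolynomial.eval γ (theta i (MvPolynomial.X j)) = if i = j then γ j else 0 := by
  rw [theta_X]
  split_ifs <;> simp

theorem theta_monomial {m : ℕ} (i : Fin m) (e : Fin m →₀ ℕ) (c : ℂ) :
    theta i (MvPolynomial.monomial e c) = (e i : ℂ) • MvPolynomial.monomial e c := by
  rw [theta, Derivation.smul_apply, MvPolynomial.pderiv_monomial, smul_eq_mul,
    MvPolynomial.X, MvPolynomial.monomial_mul, MvPolynomial.smul_monomial]
  by_cases h : e i = 0
  · simp [h]
  · have : Finsupp.single i 1 + (e - Finsupp.single i 1) = e := by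
      ext j
      by_cases hj : i = j
      · subst hj; simp; omega
      · simp [hj]
    rw [this]
    congr 1
    simp [mul_comm]

/-- The Euler operator `∑ X_i ∂_i`. -/
noncomputable def eulerOp (m : ℕ) : MvPolynomial (Fin m) ℂ →ₗ[ℂ] MvPolynomial (Fin m) ℂ :=
  ∑ i, (theta i).toLinearMap

/-- The operator `∑_{i ≠ j} X_i ∂_i X_j ∂_j`. -/
noncomputable def crossOp (m : ℕ) : MvPolynomial (Fin m) ℂ →ₗ[ℂ] MvPolynomial (Fin m) ℂ :=
  offSum fun i j => (theta i).toLinearMap ∘ₗ (theta j).toLinearMap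

theorem eulerOp_apply {m : ℕ} (P : MvPolynomial (Fin m) ℂ) : eulerOp m P = ∑ i, theta i P := by
  simp [eulerOp]

theorem crossOp_apply {m : ℕ} (P : MvPolynomial (Fin m) ℂ) :
    crossOp m P = offSum fun i j => theta i (theta j P) := by
  simp [crossOp, offSum]

theorem eulerOp_monomial {m : ℕ} (e : Fin m →₀ ℕ) (c : ℂ) :
    eulerOp m (MvPolynomial.monomial e c) = (∑ i, (e i : ℂ)) • MvPolynomial.monomial e c := by
  rw [eulerOp_apply, Finset.sum_smul]
  exact Finset.sum_congr rfl fun i _ => theta_monomial i e c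

theorem crossOp_monomial {m : ℕ} (e : Fin m →₀ ℕ) (c : ℂ) :
    crossOp m (MvPolynomial.monomial e c)
      = (offSum fun i j => (e i * e j : ℂ)) • MvPolynomial.monomial e c := by
  rw [crossOp_apply]
  simp only [offSum, Finset.sum_smul]
  refine Finset.sum_congr rfl fun i _ => Finset.sum_congr rfl fun j _ => ?_
  rw [theta_monomial, Derivation.map_smul, theta_monomial, smul_smul, mul_comm]

theorem coeff_of_diagonal {m : ℕ} (T : MvPolynomial (Fin m) ℂ →ₗ[ℂ] MvPolynomial (Fin m) ℂ)
    (w : (Fin m →₀ ℕ) → ℂ)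
    (hT : ∀ e c, T (MvPolynomial.monomial e c) = w e • MvPolynomial.monomial e c)
    (P : MvPolynomial (Fin m) ℂ) (e : Fin m →₀ ℕ) :
    MvPolynomial.coeff e (T P) = w e * MvPolynomial.coeff e P := by
  induction P using MvPolynomial.induction_on' with
  | monomial d c =>
    rw [hT, MvPolynomial.coeff_smul, MvPolynomial.coeff_monomial, smul_eq_mul]
    split_ifs with h
    · rw [h]
    · simp
  | add p q hp hq => rw [map_add, MvPolynomial.coeff_add, hp, hq, MvPolynomial.coeff_add, mul_add]

/-- The Vandermonde determinant in the variables. -/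
noncomputable def vdm (m : ℕ) : MvPolynomial (Fin m) ℂ :=
  (Matrix.vandermonde fun i : Fin m => (MvPolynomial.X i : MvPolynomial (Fin m) ℂ)).det

theorem vdm_eq_sum (m : ℕ) : vdm m = ∑ σ : Equiv.Perm (Fin m),
    MvPolynomial.monomial (Finsupp.equivFunOnFinite.symm fun i => ((σ⁻¹ i : Fin m) : ℕ))
      ((σ.sign : ℤ) : ℂ) := by
  rw [vdm, Matrix.det_apply]
  refine Finset.sum_congr rfl fun σ _ => ?_
  have h : ∏ i, (Matrix.vandermonde fun i : Fin m => (MvPolynomial.X i : MvPolynomial (Fin m) ℂ))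
      (σ i) i
      = MvPolynomial.monomial (Finsupp.equivFunOnFinite.symm fun i => ((σ⁻¹ i : Fin m) : ℕ)) 1 := by
    simp only [Matrix.vandermonde_apply]
    rw [MvPolynomial.monomial_eq, Finsupp.prod_fintype _ _ (by simp), map_one, one_mul,
      ← Equiv.prod_comp σ fun i => (MvPolynomial.X i : MvPolynomial (Fin m) ℂ) ^
        ((Finsupp.equivFunOnFinite.symm fun i => ((σ⁻¹ i : Fin m) : ℕ)) i)]
    simp
  rw [h, Units.smul_def, ← Int.cast_smul_eq_zsmul ℂ, MvPolynomial.smul_monomial, smul_eq_mul,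
    mul_one]

theorem eulerOp_vdm (m : ℕ) : eulerOp m (vdm m) = (∑ i : Fin m, ((i : ℕ) : ℂ)) • vdm m := by
  rw [vdm_eq_sum, map_sum, Finset.smul_sum]
  refine Finset.sum_congr rfl fun σ _ => ?_
  rw [eulerOp_monomial]
  congr 1
  exact Equiv.sum_comp σ⁻¹ fun i : Fin m => ((i : ℕ) : ℂ)

/-- Every exponent vector of the Vandermonde determinant is a permutation of 0, …, m - 1, and the
eigenvalue (∑ e_i)² - ∑ e_i² is invariant under permutations. -/
theorem crossOp_vdm (m : ℕ) : crossOp m (vdm m)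
    = ((∑ i : Fin m, ((i : ℕ) : ℂ)) ^ 2 - ∑ i : Fin m, ((i : ℕ) : ℂ) ^ 2) • vdm m := by
  rw [vdm_eq_sum, map_sum, Finset.smul_sum]
  refine Finset.sum_congr rfl fun σ _ => ?_
  rw [crossOp_monomial, offSum_mul]
  congr 1
  simp only [Finsupp.equivFunOnFinite_symm_apply_apply]
  rw [Equiv.sum_comp σ⁻¹ fun i : Fin m => ((i : ℕ) : ℂ),
    Equiv.sum_comp σ⁻¹ fun i : Fin m => ((i : ℕ) : ℂ) * ((i : ℕ) : ℂ), sq]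
  simp_rw [sq]

/-- The logarithmic derivative of a product is the sum of the logarithmic derivatives. -/
theorem eval_derivation_prod {m : ℕ} {ι : Type*}
    (D : Derivation ℂ (MvPolynomial (Fin m) ℂ) (MvPolynomial (Fin m) ℂ)) (γ : Fin m → ℂ)
    (s : Finset ι) (f : ι → MvPolynomial (Fin m) ℂ) (hf : ∀ i ∈ s, MvPolynomial.eval γ (f i) ≠ 0) :
    MvPolynomial.eval γ (D (∏ i ∈ s, f i)) = MvPolynomial.eval γ (∏ i ∈ s, f i) *
      ∑ i ∈ s, MvPolynomial.eval γ (D (f i)) / MvPolynomial.eval γ (f i) := by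
  classical
  induction s using Finset.induction_on with
  | empty => simp
  | insert a s ha ih =>
    rw [Finset.prod_insert ha, Finset.sum_insert ha, Derivation.leibniz]
    simp only [smul_eq_mul, map_add, map_mul]
    rw [ih fun i hi => hf i (Finset.mem_insert_of_mem hi)]
    have := hf a (Finset.mem_insert_self a s)
    field_simp
    ring

theorem eval_vdm {m : ℕ} (γ : Fin m → ℂ) :
    MvPolynomial.eval γ (vdm m) = (Matrix.vandermonde γ).det := by
  rw [vdm, RingHom.map_det]
  congr 1
  ext i j
  simp [Matrix.vandermonde_apply]

theorem eval_theta_vdm {m : ℕ} {γ : Fin m → ℂ} (hγ : Function.Injective γ) (a : Fin m) :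
    MvPolynomial.eval γ (theta a (vdm m))
      = MvPolynomial.eval γ (vdm m) * ∑ l ∈ Finset.univ.erase a, γ a / (γ a - γ l) := by
  have hprod : vdm m = ∏ p ∈ Finset.univ.sigma fun i : Fin m => Finset.Ioi i,
      ((MvPolynomial.X p.2 : MvPolynomial (Fin m) ℂ) - MvPolynomial.X p.1) := by
    rw [vdm, Matrix.det_vandermonde, Finset.prod_sigma]
  rw [hprod, eval_derivation_prod]
  · congr 1
    rw [Finset.sum_sigma]
    simp only [map_sub, eval_theta_X, MvPolynomial.eval_X, sub_div]
    simp only [Finset.sum_sub_distrib]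
    have h1 : ∑ x : Fin m, ∑ x_1 ∈ Finset.Ioi x,
        (if a = x_1 then γ x_1 else 0) / (γ x_1 - γ x) = ∑ x ∈ Finset.Iio a, γ a / (γ a - γ x) := by
      rw [← Finset.sum_filter_add_sum_filter_not Finset.univ (fun x => x < a)]
      rw [Finset.sum_eq_zero (s := Finset.univ.filter fun x => ¬ x < a), add_zero]
      · refine Finset.sum_congr (by ext; simp) fun x hx => ?_
        rw [Finset.sum_eq_single a]
        · simp
        · intro b _ hb; simp [hb.symm]
        · intro h; simp at hx; simp [hx] at h
      · intro x hx
        refine Finset.sum_eq_zero fun y hy => ?_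
        have : a ≠ y := by
          rintro rfl
          simp at hx hy
          exact absurd hy (not_lt.2 hx)
        simp [this]
    have h2 : ∑ x : Fin m, ∑ x_1 ∈ Finset.Ioi x,
        (if a = x then γ x else 0) / (γ x_1 - γ x) = ∑ x ∈ Finset.Ioi a, γ a / (γ x - γ a) := by
      rw [Finset.sum_eq_single a]
      · simp
      · intro b _ hb; simp [hb.symm]
      · simp
    rw [h1, h2]
    have h3 : (Finset.univ.erase a : Finset (Fin m)) = Finset.Iio a ∪ Finset.Ioi a := by
      ext x; simp [lt_or_lt_iff_ne]
    rw [h3, Finset.sum_union, sub_eq_add_neg, ← Finset.sum_neg_distrib]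
    · congr 1
      refine Finset.sum_congr rfl fun x _ => ?_
      rw [← neg_sub (γ a), div_neg, neg_neg]
    · rw [Finset.disjoint_left]; intro x hx hx'; simp at hx hx'; exact lt_asymm hx hx'
  · rintro ⟨i, j⟩ hp
    simp at hp
    simpa using sub_ne_zero.2 (hγ.ne hp.ne')

end CUE

/-! ### Derivatives of characteristic polynomials through resolvents -/

open MeasureTheory ProbabilityTheory

namespace CUE

open Matrix

/-- Jacobi's formula, read off from det(γ + x - A) = det(B) det(1 + x B⁻¹) with B = γ - A. -/
theorem derivative_charpoly_eval {n : ℕ} (A : Matrix (Fin n) (Fin n) ℂ) (γ : ℂ)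
    (h : (γ • (1 : Matrix (Fin n) (Fin n) ℂ) - A).det ≠ 0) :
    A.charpoly.derivative.eval γ = (γ • (1 : Matrix (Fin n) (Fin n) ℂ) - A).det *
      ((γ • (1 : Matrix (Fin n) (Fin n) ℂ) - A)⁻¹).trace := by
  set B := γ • (1 : Matrix (Fin n) (Fin n) ℂ) - A with hB
  have key : A.charpoly.comp (Polynomial.C γ + Polynomial.X) = Polynomial.C B.det *
      (1 + (Polynomial.X : Polynomial ℂ) • (B⁻¹).map Polynomial.C).det := by
    refine Polynomial.funext fun x => ?_
    rw [Polynomial.eval_comp, Matrix.eval_charpoly, Polynomial.eval_mul, Polynomial.eval_C,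
      ← Polynomial.coe_evalRingHom, RingHom.map_det, ← det_mul]
    congr 1
    have : (Polynomial.evalRingHom x).mapMatrix
        (1 + (Polynomial.X : Polynomial ℂ) • (B⁻¹).map Polynomial.C) = 1 + x • B⁻¹ := by
      ext i j
      by_cases hij : i = j <;> simp [hij] <;> exact mul_comm _ _
    rw [this, mul_add, mul_one, mul_smul_comm, Matrix.mul_nonsing_inv _ h.isUnit]
    simp only [hB, Polynomial.coe_evalRingHom, Polynomial.eval_add, Polynomial.eval_C,
      Polynomial.eval_X, Matrix.scalar_apply, ← Matrix.smul_one_eq_diagonal, add_smul]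
    abel
  have h1 := congrArg (fun p => (Polynomial.derivative p).eval 0) key
  simp only [Polynomial.derivative_comp, Polynomial.derivative_mul, Polynomial.derivative_C,
    Polynomial.derivative_add, Polynomial.derivative_X, zero_mul, zero_add, Polynomial.eval_mul,
    Polynomial.eval_comp, Polynomial.eval_add, Polynomial.eval_C, Polynomial.eval_X, add_zero,
    one_mul, Matrix.derivative_det_one_add_X_smul] at h1
  exact h1

theorem smul_inv_eq_one_add_resolv {n : ℕ} (u : U n) {γ : ℂ} (hγ : ‖γ‖ ≠ 1) :
    γ • (γ • (1 : Matrix (Fin n) (Fin n) ℂ) - u.1)⁻¹ = 1 + resolv γ u := by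
  have h := Matrix.mul_nonsing_inv _ (det_smul_one_sub_ne_zero u hγ).isUnit
  rw [sub_mul, smul_mul_assoc, one_mul] at h
  exact sub_eq_iff_eq_add.1 h

theorem mul_derivative_charpoly_eval {n : ℕ} (u : U n) {γ : ℂ} (hγ : ‖γ‖ ≠ 1) :
    γ * u.1.charpoly.derivative.eval γ
      = (γ • (1 : Matrix (Fin n) (Fin n) ℂ) - u.1).det * (n + (resolv γ u).trace) := by
  rw [derivative_charpoly_eval _ _ (det_smul_one_sub_ne_zero u hγ), mul_left_comm, ← smul_eq_mul γ,
    ← Matrix.trace_smul, smul_inv_eq_one_add_resolv u hγ, Matrix.trace_add, Matrix.trace_one,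
    Fintype.card_fin]

theorem commute_inv_sub {n : ℕ} (u : U n) {γ : ℂ} (hγ : ‖γ‖ ≠ 1) :
    Commute u.1 (γ • (1 : Matrix (Fin n) (Fin n) ℂ) - u.1)⁻¹ := by
  have h : Commute u.1 (γ • (1 : Matrix (Fin n) (Fin n) ℂ) - u.1) :=
    ((Commute.one_right u.1).smul_right γ).sub_right (Commute.refl _)
  have hu := (det_smul_one_sub_ne_zero u hγ).isUnit
  calc _ = (γ • (1 : Matrix (Fin n) (Fin n) ℂ) - u.1)⁻¹ *
        ((γ • (1 : Matrix (Fin n) (Fin n) ℂ) - u.1) * u.1) *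
          (γ • (1 : Matrix (Fin n) (Fin n) ℂ) - u.1)⁻¹ := by
        rw [Matrix.nonsing_inv_mul_cancel_left _ _ hu]
    _ = _ := by rw [← h.eq, ← mul_assoc, Matrix.mul_nonsing_inv_cancel_right _ _ hu]

/-- The resolvent identity A⁻¹ - B⁻¹ = (y - x) A⁻¹ B⁻¹, multiplied by u² and combined with z R_z = u
+ u R_z, where R_z = u (z - u)⁻¹. -/
theorem trace_resolv_mul_resolv {n : ℕ} (u : U n) {x y : ℂ} (hx : ‖x‖ ≠ 1) (hy : ‖y‖ ≠ 1) :
    (y - x) * (resolv x u * resolv y u).trace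
      = x * (resolv x u).trace - y * (resolv y u).trace := by
  set A := x • (1 : Matrix (Fin n) (Fin n) ℂ) - u.1 with hA
  set B := y • (1 : Matrix (Fin n) (Fin n) ℂ) - u.1 with hB
  have hA1 : A⁻¹ * A = 1 := Matrix.nonsing_inv_mul _ (det_smul_one_sub_ne_zero u hx).isUnit
  have hB1 : B * B⁻¹ = 1 := Matrix.mul_nonsing_inv _ (det_smul_one_sub_ne_zero u hy).isUnit
  have hsub : A⁻¹ - B⁻¹ = (y - x) • (A⁻¹ * B⁻¹) := by
    have : (y - x) • (1 : Matrix (Fin n) (Fin n) ℂ) = B - A := by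
      rw [hA, hB, sub_smul]; abel
    calc A⁻¹ - B⁻¹ = A⁻¹ * (B * B⁻¹) - A⁻¹ * A * B⁻¹ := by rw [hA1, hB1, mul_one, one_mul]
      _ = A⁻¹ * (B - A) * B⁻¹ := by noncomm_ring
      _ = _ := by rw [← this, mul_smul_comm, mul_one, smul_mul_assoc]
  have h1 : resolv x u * resolv y u = u.1 * u.1 * (A⁻¹ * B⁻¹) := by
    have := (commute_inv_sub u hx).eq
    rw [← hA] at this
    rw [resolv, resolv, ← hA, ← hB, mul_assoc, ← mul_assoc A⁻¹, ← this]
    noncomm_ring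
  have h2 : ∀ z : ℂ, ‖z‖ ≠ 1 → z • resolv z u = u.1 + u.1 * resolv z u := by
    intro z hz
    conv_lhs => rw [resolv]
    rw [← mul_smul_comm, smul_inv_eq_one_add_resolv u hz, mul_add, mul_one]
  have h3 : ∀ (z : ℂ) (M : Matrix (Fin n) (Fin n) ℂ), z * M.trace = (z • M).trace := fun z M => by
    rw [Matrix.trace_smul, smul_eq_mul]
  rw [h3, h3, h3, ← Matrix.trace_sub]
  congr 1
  rw [h2 x hx, h2 y hy, h1, ← mul_smul_comm, ← hsub, resolv, resolv, ← hA, ← hB]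
  noncomm_ring

/-- Polarizing `quadTrace` shows that its off-diagonal part is exactly what `offSum_symmetrize`
leaves. -/
theorem quadTrace_sum {n m : ℕ} (R : Fin m → Matrix (Fin n) (Fin n) ℂ) :
    quadTrace (∑ j, R j) - ∑ j, quadTrace (R j)
      = offSum fun i j => (R i).trace * (R j).trace + (R i * R j).trace := by
  rw [offSum_add, offSum_mul, offSum_eq_sub]
  simp only [quadTrace, Matrix.trace_sum, Finset.sum_mul_sum, Finset.sum_add_distrib, sq]
  ring

/-- The product over the variables of the characteristic polynomial of `A`. -/
noncomputable def cpProd {n : ℕ} (m : ℕ) (A : Matrix (Fin n) (Fin n) ℂ) :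
    MvPolynomial (Fin m) ℂ :=
  ∏ j, Polynomial.aeval (MvPolynomial.X j : MvPolynomial (Fin m) ℂ) A.charpoly

theorem eval_aeval_X {m : ℕ} (γ : Fin m → ℂ) (j : Fin m) (p : Polynomial ℂ) :
    MvPolynomial.eval γ (Polynomial.aeval (MvPolynomial.X j : MvPolynomial (Fin m) ℂ) p)
      = p.eval (γ j) := by
  induction p using Polynomial.induction_on' with
  | add p q hp hq => rw [map_add, map_add, hp, hq, Polynomial.eval_add]
  | monomial k c => simp [Polynomial.aeval_monomial, MvPolynomial.algebraMap_eq]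

theorem eval_cpProd {n m : ℕ} (A : Matrix (Fin n) (Fin n) ℂ) (γ : Fin m → ℂ) :
    MvPolynomial.eval γ (cpProd m A)
      = ∏ j, (γ j • (1 : Matrix (Fin n) (Fin n) ℂ) - A).det := by
  rw [cpProd, map_prod]
  refine Finset.prod_congr rfl fun j _ => ?_
  rw [eval_aeval_X, Matrix.eval_charpoly, Matrix.scalar_apply, Matrix.smul_one_eq_diagonal]

theorem theta_aeval {m : ℕ} (i j : Fin m) (p : Polynomial ℂ) :
    theta i (Polynomial.aeval (MvPolynomial.X j : MvPolynomial (Fin m) ℂ) p)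
      = if i = j then Polynomial.aeval (MvPolynomial.X j : MvPolynomial (Fin m) ℂ)
          (Polynomial.X * Polynomial.derivative p) else 0 := by
  rw [Derivation.map_aeval, theta_X]
  split_ifs <;> simp [mul_comm]

theorem theta_prod_aeval {m : ℕ} (i : Fin m) (p : Fin m → Polynomial ℂ) :
    theta i (∏ j, Polynomial.aeval (MvPolynomial.X j : MvPolynomial (Fin m) ℂ) (p j))
      = ∏ j, Polynomial.aeval (MvPolynomial.X j : MvPolynomial (Fin m) ℂ)
          (Function.update p i (Polynomial.X * Polynomial.derivative (p i)) j) := by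
  have h : ∀ s : Finset (Fin m), i ∉ s →
      theta i (∏ j ∈ s, Polynomial.aeval (MvPolynomial.X j : MvPolynomial (Fin m) ℂ) (p j)) = 0 := by
    intro s
    induction s using Finset.induction_on with
    | empty => simp
    | insert a s ha ih =>
      intro hi
      rw [Finset.mem_insert, not_or] at hi
      rw [Finset.prod_insert ha, Derivation.leibniz, ih hi.2, theta_aeval, if_neg hi.1]
      simp
  rw [← Finset.mul_prod_erase _ _ (Finset.mem_univ i), Derivation.leibniz,
    h _ (Finset.notMem_erase _ _), theta_aeval, if_pos rfl,
    ← Finset.mul_prod_erase Finset.univ _ (Finset.mem_univ i), Function.update_self, smul_zero,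
    zero_add, smul_eq_mul, mul_comm]
  congr 1
  refine Finset.prod_congr rfl fun j hj => ?_
  rw [Function.update_of_ne (Finset.ne_of_mem_erase hj)]

theorem eval_theta_cpProd {n m : ℕ} (u : U n) {γ : Fin m → ℂ} (hγ : ∀ j, ‖γ j‖ ≠ 1) (i : Fin m) :
    MvPolynomial.eval γ (theta i (cpProd m u.1))
      = MvPolynomial.eval γ (cpProd m u.1) * (n + (resolv (γ i) u).trace) := by
  rw [eval_cpProd, cpProd, theta_prod_aeval, map_prod]
  simp_rw [eval_aeval_X]
  rw [← Finset.mul_prod_erase _ _ (Finset.mem_univ i),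
    ← Finset.mul_prod_erase Finset.univ (fun j => (γ j • (1 : Matrix (Fin n) (Fin n) ℂ) - u.1).det)
      (Finset.mem_univ i), Function.update_self, Polynomial.eval_mul, Polynomial.eval_X,
      mul_derivative_charpoly_eval u (hγ i), mul_right_comm]
  congr 2
  refine Finset.prod_congr rfl fun j hj => ?_
  rw [Function.update_of_ne (Finset.ne_of_mem_erase hj), Matrix.eval_charpoly, Matrix.scalar_apply,
    Matrix.smul_one_eq_diagonal]

theorem eval_theta_theta_cpProd {n m : ℕ} (u : U n) {γ : Fin m → ℂ} (hγ : ∀ j, ‖γ j‖ ≠ 1)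
    {i j : Fin m} (hij : i ≠ j) :
    MvPolynomial.eval γ (theta i (theta j (cpProd m u.1)))
      = MvPolynomial.eval γ (cpProd m u.1) *
        ((n + (resolv (γ i) u).trace) * (n + (resolv (γ j) u).trace)) := by
  rw [eval_cpProd, cpProd, theta_prod_aeval, theta_prod_aeval, map_prod]
  simp_rw [eval_aeval_X]
  have hj : j ∈ Finset.univ.erase i := Finset.mem_erase.2 ⟨hij.symm, Finset.mem_univ j⟩
  rw [← Finset.mul_prod_erase _ _ (Finset.mem_univ i),
    ← Finset.mul_prod_erase _ _ hj,
    ← Finset.mul_prod_erase Finset.univ (fun j => (γ j • (1 : Matrix (Fin n) (Fin n) ℂ) - u.1).det)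
      (Finset.mem_univ i), ← Finset.mul_prod_erase (Finset.univ.erase i)
      (fun j => (γ j • (1 : Matrix (Fin n) (Fin n) ℂ) - u.1).det) hj,
    Function.update_self, Function.update_of_ne hij.symm, Function.update_of_ne hij,
    Function.update_self, Polynomial.eval_mul, Polynomial.eval_X, Polynomial.eval_mul,
    Polynomial.eval_X,
    mul_derivative_charpoly_eval u (hγ i), mul_derivative_charpoly_eval u (hγ j)]
  have : ∀ k ∈ (Finset.univ.erase i).erase j,
      (Function.update (Function.update (fun _ => u.1.charpoly) j
        (Polynomial.X * Polynomial.derivative u.1.charpoly)) i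
        (Polynomial.X * Polynomial.derivative u.1.charpoly) k).eval (γ k)
      = (γ k • (1 : Matrix (Fin n) (Fin n) ℂ) - u.1).det := by
    intro k hk
    rw [Function.update_of_ne (Finset.ne_of_mem_erase (Finset.mem_of_mem_erase hk)),
      Function.update_of_ne (Finset.ne_of_mem_erase hk), Matrix.eval_charpoly, Matrix.scalar_apply,
      Matrix.smul_one_eq_diagonal]
  rw [Finset.prod_congr rfl this]
  ring

theorem eval_eulerOp_vdm_mul_cpProd {n m : ℕ} (u : U n) {γ : Fin m → ℂ} (hγ : ∀ j, ‖γ j‖ ≠ 1) :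
    MvPolynomial.eval γ (eulerOp m (vdm m * cpProd m u.1))
      = MvPolynomial.eval γ (vdm m) * (MvPolynomial.eval γ (cpProd m u.1) *
        ((∑ i : Fin m, ((i : ℕ) : ℂ)) + n * m + ∑ j, (resolv (γ j) u).trace)) := by
  have h : eulerOp m (vdm m * cpProd m u.1)
      = vdm m * ∑ i, theta i (cpProd m u.1) + cpProd m u.1 * eulerOp m (vdm m) := by
    simp only [eulerOp_apply, Derivation.leibniz, smul_eq_mul, Finset.sum_add_distrib,
      Finset.mul_sum]
  rw [h, eulerOp_vdm]
  simp only [map_add, map_mul, map_sum, eval_theta_cpProd u hγ, MvPolynomial.smul_eval,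
    ← Finset.mul_sum, Finset.sum_add_distrib, Finset.sum_const, Finset.card_univ,
    Fintype.card_fin, nsmul_eq_mul]
  ring

/-- Leibniz splits θ_i θ_j of the product into the Vandermonde eigenvalue, mixed terms in
logarithmic derivatives, and a pure term; `offSum_symmetrize` eliminates the singular quotients
1/(γ_i - γ_l). -/
theorem eval_crossOp_vdm_mul_cpProd {n m : ℕ} (u : U n) {γ : Fin m → ℂ} (hγ : ∀ j, ‖γ j‖ ≠ 1)
    (hinj : Function.Injective γ) (hV : MvPolynomial.eval γ (vdm m) ≠ 0) :
    MvPolynomial.eval γ (crossOp m (vdm m * cpProd m u.1))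
      = MvPolynomial.eval γ (vdm m) * (MvPolynomial.eval γ (cpProd m u.1) *
        ((∑ i : Fin m, ((i : ℕ) : ℂ)) ^ 2 - ∑ i : Fin m, ((i : ℕ) : ℂ) ^ 2
          + 2 * n * (m - 1) * (∑ i : Fin m, ((i : ℕ) : ℂ)) + m * (m - 1) * n ^ 2
          + (2 * (∑ i : Fin m, ((i : ℕ) : ℂ)) + 2 * n * (m - 1)) * ∑ j, (resolv (γ j) u).trace
          + (quadTrace (∑ j, resolv (γ j) u) - ∑ j, quadTrace (resolv (γ j) u)))) := by
  set s : ℂ := ∑ i : Fin m, ((i : ℕ) : ℂ) with hs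
  -- The logarithmic derivatives of the Vandermonde determinant add up to its degree, by the Euler
  -- operator.
  have hA : ∑ i, ∑ l ∈ Finset.univ.erase i, γ i / (γ i - γ l) = s := by
    have h1 := congrArg (MvPolynomial.eval γ) (eulerOp_vdm m)
    rw [eulerOp_apply, map_sum, MvPolynomial.smul_eval] at h1
    simp_rw [eval_theta_vdm hinj] at h1
    rw [← Finset.mul_sum, mul_comm] at h1
    exact mul_right_cancel₀ hV h1
  have hcross : crossOp m (vdm m * cpProd m u.1)
      = cpProd m u.1 * crossOp m (vdm m) + offSum fun i j =>
        theta j (vdm m) * theta i (cpProd m u.1) + theta i (vdm m) * theta j (cpProd m u.1)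
          + vdm m * theta i (theta j (cpProd m u.1)) := by
    have e : cpProd m u.1 * crossOp m (vdm m)
        = offSum fun i j => cpProd m u.1 * theta i (theta j (vdm m)) := by
      simp only [crossOp_apply, offSum, Finset.mul_sum]
    rw [e, crossOp_apply, ← offSum_add]
    refine offSum_congr fun i j _ => ?_
    simp only [Derivation.leibniz, smul_eq_mul, map_add]
    ring
  have hoff : ∀ F : Fin m → Fin m → MvPolynomial (Fin m) ℂ,
      MvPolynomial.eval γ (offSum F) = offSum fun i j => MvPolynomial.eval γ (F i j) := by
    intro F; simp only [offSum, map_sum]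
  rw [hcross, map_add, hoff, map_mul, crossOp_vdm, MvPolynomial.smul_eval, quadTrace_sum]
  have h2 := offSum_symmetrize (n := n) hinj (t := fun i => (resolv (γ i) u).trace)
    (ρ := fun i j => (resolv (γ i) u * resolv (γ j) u).trace)
    (fun i j => trace_resolv_mul_resolv u (hγ i) (hγ j)) hA
  have h3 : (offSum fun i j => MvPolynomial.eval γ
      (theta j (vdm m) * theta i (cpProd m u.1) + theta i (vdm m) * theta j (cpProd m u.1)
          + vdm m * theta i (theta j (cpProd m u.1))))
      = (MvPolynomial.eval γ (vdm m) * MvPolynomial.eval γ (cpProd m u.1)) *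
        offSum (fun i j => (∑ l ∈ Finset.univ.erase j, γ j / (γ j - γ l))
            * (n + (resolv (γ i) u).trace)
          + (∑ l ∈ Finset.univ.erase i, γ i / (γ i - γ l)) * (n + (resolv (γ j) u).trace)
          + (n + (resolv (γ i) u).trace) * (n + (resolv (γ j) u).trace)) := by
    rw [mul_offSum]
    refine offSum_congr fun i j hij => ?_
    simp only [map_add, map_mul, eval_theta_cpProd u hγ, eval_theta_vdm hinj,
      eval_theta_theta_cpProd u hγ hij]
    ring
  rw [h3, h2]
  ring

end CUE

/-! ### The mean polynomial: eigenvalue equations, symmetry, degree -/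

open MeasureTheory ProbabilityTheory

namespace CUE

open Matrix

theorem continuous_charpoly_coeff {n : ℕ} (i : ℕ) :
    Continuous fun u : U n => u.1.charpoly.coeff i := by
  refine continuous_coeff_of_eval (d := n) (fun u => ?_) (fun x => ?_) i
  · rw [Matrix.charpoly_natDegree_eq_dim, Fintype.card_fin]
  · simp_rw [Matrix.eval_charpoly, Matrix.scalar_apply, ← Matrix.smul_one_eq_diagonal]
    exact continuous_det_sub x

theorem continuous_det_pow_inv {n : ℕ} (r : ℕ) : Continuous fun u : U n => (u.1.det ^ r)⁻¹ :=
  ((continuous_coeU.matrix_det).pow r).inv₀ fun u => pow_ne_zero _ (det_coeU_ne_zero u)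

theorem cpProd_eq_sum {n : ℕ} (m : ℕ) (A : Matrix (Fin n) (Fin n) ℂ) :
    cpProd m A = ∑ c ∈ Fintype.piFinset fun _ : Fin m => Finset.range (n + 1),
      (∏ j, A.charpoly.coeff (c j)) •
        MvPolynomial.monomial (Finsupp.equivFunOnFinite.symm c) (1 : ℂ) := by
  have h : ∀ j : Fin m, Polynomial.aeval (MvPolynomial.X j : MvPolynomial (Fin m) ℂ) A.charpoly
      = ∑ i ∈ Finset.range (n + 1), A.charpoly.coeff i • (MvPolynomial.X j) ^ i := by
    intro j
    rw [Polynomial.aeval_eq_sum_range, Matrix.charpoly_natDegree_eq_dim, Fintype.card_fin]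
  rw [cpProd, Finset.prod_congr rfl fun j _ => h j, Finset.prod_univ_sum]
  refine Finset.sum_congr rfl fun c _ => ?_
  rw [Finset.prod_smul, MvPolynomial.monomial_eq, Finsupp.prod_fintype _ _ (by simp), map_one,
    one_mul]
  rfl

/-- The polynomial `γ ↦ E[det(u)^{-r} ∏ det(γ_j - u)]`. -/
noncomputable def meanCp (n m r : ℕ) : MvPolynomial (Fin m) ℂ :=
  ∑ c ∈ Fintype.piFinset fun _ : Fin m => Finset.range (n + 1),
    (∫ u : U n, (u.1.det ^ r)⁻¹ * ∏ j, u.1.charpoly.coeff (c j) ∂haar n) •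
      MvPolynomial.monomial (Finsupp.equivFunOnFinite.symm c) (1 : ℂ)

/-- A linear functional passes under the expectation because only finitely many monomials, with
continuous coefficients, occur. Differential operators followed by evaluation are such functionals.
-/
theorem linear_meanCp {n m : ℕ} (r : ℕ) (l : MvPolynomial (Fin m) ℂ →ₗ[ℂ] ℂ) :
    l (meanCp n m r) = ∫ u : U n, (u.1.det ^ r)⁻¹ * l (cpProd m u.1) ∂haar n := by
  have hi : ∀ c ∈ Fintype.piFinset fun _ : Fin m => Finset.range (n + 1),
      Integrable (fun u : U n => (u.1.det ^ r)⁻¹ * (∏ j, u.1.charpoly.coeff (c j)) *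
        l (MvPolynomial.monomial (Finsupp.equivFunOnFinite.symm c) (1 : ℂ))) (haar n) :=
    fun c _ => integrable_haar (((continuous_det_pow_inv r).mul
      (continuous_finsetProd _ fun j _ => continuous_charpoly_coeff _)).mul continuous_const)
  simp_rw [cpProd_eq_sum, map_sum, map_smul, smul_eq_mul, Finset.mul_sum, ← mul_assoc]
  rw [integral_finsetSum _ hi, meanCp, map_sum]
  refine Finset.sum_congr rfl fun c _ => ?_
  rw [map_smul, smul_eq_mul, integral_mul_const]

/-- Evaluation of polynomials as a linear map. -/
noncomputable def evalLin {m : ℕ} (γ : Fin m → ℂ) : MvPolynomial (Fin m) ℂ →ₗ[ℂ] ℂ :=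
  (MvPolynomial.aeval γ).toLinearMap

theorem evalLin_apply {m : ℕ} (γ : Fin m → ℂ) (P : MvPolynomial (Fin m) ℂ) :
    evalLin γ P = MvPolynomial.eval γ P := by
  simp [evalLin, MvPolynomial.aeval_eq_eval]

theorem detProd_eq {n m : ℕ} (r : ℕ) (γ : Fin m → ℂ) (u : U n) :
    (u.1.det ^ r)⁻¹ * MvPolynomial.eval γ (cpProd m u.1) = detProd r γ u := by
  rw [eval_cpProd, detProd]

theorem eval_meanCp {n m : ℕ} (r : ℕ) (γ : Fin m → ℂ) :
    MvPolynomial.eval γ (meanCp n m r) = ∫ u : U n, detProd r γ u ∂haar n := by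
  rw [← evalLin_apply, linear_meanCp]
  simp_rw [evalLin_apply, detProd_eq]

theorem eval_eulerOp_meanCp {n m : ℕ} (r : ℕ) {γ : Fin m → ℂ} (hγ : ∀ j, ‖γ j‖ ≠ 1) :
    MvPolynomial.eval γ (eulerOp m (vdm m * meanCp n m r))
      = ((∑ i : Fin m, ((i : ℕ) : ℂ)) + n * m - r * n) *
        MvPolynomial.eval γ (vdm m * meanCp n m r) := by
  have h := linear_meanCp (n := n) r
    (evalLin γ ∘ₗ eulerOp m ∘ₗ LinearMap.mulLeft ℂ (vdm m))
  simp only [LinearMap.comp_apply, LinearMap.mulLeft_apply, evalLin_apply,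
    eval_eulerOp_vdm_mul_cpProd _ hγ] at h
  rw [h, map_mul, eval_meanCp]
  have e : ∀ u : U n, (u.1.det ^ r)⁻¹ * (MvPolynomial.eval γ (vdm m) *
      (MvPolynomial.eval γ (cpProd m u.1) *
        ((∑ i : Fin m, ((i : ℕ) : ℂ)) + n * m + ∑ j, (resolv (γ j) u).trace)))
      = MvPolynomial.eval γ (vdm m) * (((∑ i : Fin m, ((i : ℕ) : ℂ)) + n * m) * detProd r γ u)
        + MvPolynomial.eval γ (vdm m) * (detProd r γ u * ∑ j, (resolv (γ j) u).trace) := by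
    intro u; rw [← detProd_eq]; ring
  simp_rw [e]
  rw [integral_add, integral_const_mul, integral_const_mul, integral_const_mul,
    integral_trace_resolv r hγ]
  · ring
  · exact ((integrable_haar (continuous_detProd r γ)).const_mul _).const_mul _
  · exact (integrable_haar ((continuous_detProd r γ).mul
      (continuous_finsetSum _ fun j _ => (continuous_resolv (hγ j)).matrix_trace))).const_mul _

theorem continuous_quadTrace {n : ℕ} :
    Continuous (quadTrace : Matrix (Fin n) (Fin n) ℂ → ℂ) :=
  ((continuous_id.matrix_trace).pow 2).add (continuous_id.matrix_mul continuous_id).matrix_trace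

/-- In expectation the traces and the quadratic traces of the resolvents become constants times E of
`detProd`, so the pointwise formula turns into an eigenvalue equation. -/
theorem eval_crossOp_meanCp {n m : ℕ} (r : ℕ) {γ : Fin m → ℂ} (hγ : ∀ j, ‖γ j‖ ≠ 1)
    (hinj : Function.Injective γ) (hV : MvPolynomial.eval γ (vdm m) ≠ 0) :
    MvPolynomial.eval γ (crossOp m (vdm m * meanCp n m r))
      = ((∑ i : Fin m, ((i : ℕ) : ℂ)) ^ 2 - ∑ i : Fin m, ((i : ℕ) : ℂ) ^ 2
          + 2 * n * (m - 1) * (∑ i : Fin m, ((i : ℕ) : ℂ)) + m * (m - 1) * n ^ 2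
          - r * n * (2 * (∑ i : Fin m, ((i : ℕ) : ℂ)) + 2 * n * (m - 1))
          + r * (r - 1) * (n ^ 2 + n)) *
        MvPolynomial.eval γ (vdm m * meanCp n m r) := by
  have h := linear_meanCp (n := n) r
    (evalLin γ ∘ₗ crossOp m ∘ₗ LinearMap.mulLeft ℂ (vdm m))
  simp only [LinearMap.comp_apply, LinearMap.mulLeft_apply, evalLin_apply,
    eval_crossOp_vdm_mul_cpProd _ hγ hinj hV] at h
  rw [h, map_mul, eval_meanCp]
  set a : ℂ := (∑ i : Fin m, ((i : ℕ) : ℂ)) ^ 2 - ∑ i : Fin m, ((i : ℕ) : ℂ) ^ 2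
          + 2 * n * (m - 1) * (∑ i : Fin m, ((i : ℕ) : ℂ)) + m * (m - 1) * n ^ 2
  set b : ℂ := 2 * (∑ i : Fin m, ((i : ℕ) : ℂ)) + 2 * n * (m - 1)
  have e : ∀ u : U n, (u.1.det ^ r)⁻¹ * (MvPolynomial.eval γ (vdm m) *
      (MvPolynomial.eval γ (cpProd m u.1) * (a + b * ∑ j, (resolv (γ j) u).trace
        + (quadTrace (∑ j, resolv (γ j) u) - ∑ j, quadTrace (resolv (γ j) u)))))
      = MvPolynomial.eval γ (vdm m) * (a * detProd r γ u)
        + MvPolynomial.eval γ (vdm m) * (b * (detProd r γ u * ∑ j, (resolv (γ j) u).trace))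
        + MvPolynomial.eval γ (vdm m) * (detProd r γ u *
          (quadTrace (∑ j, resolv (γ j) u) - ∑ j, quadTrace (resolv (γ j) u))) := by
    intro u; rw [← detProd_eq]; ring
  simp_rw [e]
  have i1 : Integrable (fun u : U n => MvPolynomial.eval γ (vdm m) * (a * detProd r γ u))
      (haar n) := ((integrable_haar (continuous_detProd r γ)).const_mul _).const_mul _
  have i2 : Integrable (fun u : U n => MvPolynomial.eval γ (vdm m) *
      (b * (detProd r γ u * ∑ j, (resolv (γ j) u).trace))) (haar n) :=
    ((integrable_haar ((continuous_detProd r γ).mul (continuous_finsetSum _ fun j _ =>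
      (continuous_resolv (hγ j)).matrix_trace))).const_mul _).const_mul _
  have i3 : Integrable (fun u : U n => MvPolynomial.eval γ (vdm m) * (detProd r γ u *
      (quadTrace (∑ j, resolv (γ j) u) - ∑ j, quadTrace (resolv (γ j) u)))) (haar n) :=
    (integrable_haar ((continuous_detProd r γ).mul
      ((continuous_quadTrace.comp (continuous_finsetSum _ fun j _ =>
        continuous_resolv (hγ j))).sub (continuous_finsetSum _ fun j _ =>
          continuous_quadTrace.comp (continuous_resolv (hγ j)))))).const_mul _
  have i12 : Integrable (fun u : U n => MvPolynomial.eval γ (vdm m) * (a * detProd r γ u)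
      + MvPolynomial.eval γ (vdm m) * (b * (detProd r γ u * ∑ j, (resolv (γ j) u).trace)))
      (haar n) := i1.add i2
  rw [integral_add i12 i3, integral_add i1 i2, integral_const_mul, integral_const_mul,
    integral_const_mul, integral_const_mul, integral_const_mul,
    integral_trace_resolv r hγ, integral_quadTrace_resolv r hγ]
  ring

/-- It suffices to test on a product of infinite sets. The disjoint real intervals (j + 2, j + 3)
make the coordinates distinct, of modulus > 1, with nonzero Vandermonde determinant. -/
theorem eq_of_eval_eq_generic {m : ℕ} {P Q : MvPolynomial (Fin m) ℂ}
    (h : ∀ γ : Fin m → ℂ, (∀ j, ‖γ j‖ ≠ 1) → Function.Injective γ →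
      MvPolynomial.eval γ (vdm m) ≠ 0 → MvPolynomial.eval γ P = MvPolynomial.eval γ Q) : P = Q := by
  refine MvPolynomial.funext_set
    (fun j : Fin m => (fun t : ℝ => (t : ℂ)) '' Set.Ioo ((j : ℕ) + 2 : ℝ) ((j : ℕ) + 3))
    (fun j => (Set.Ioo_infinite (by linarith)).image (Complex.ofReal_injective.injOn)) ?_
  intro γ hγ
  have hγ' : ∀ j : Fin m, ∃ t : ℝ, ((j : ℕ) + 2 : ℝ) < t ∧ t < (j : ℕ) + 3 ∧ (t : ℂ) = γ j := by
    intro j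
    obtain ⟨t, ht, h⟩ := hγ j (Set.mem_univ j)
    exact ⟨t, ht.1, ht.2, h⟩
  choose t ht1 ht2 ht using hγ'
  have hinj : Function.Injective γ := by
    intro i j hij
    rw [← ht, ← ht] at hij
    have hij' := Complex.ofReal_injective hij
    have h1 := ht1 i; have h2 := ht2 i; have h3 := ht1 j; have h4 := ht2 j
    rw [hij'] at h1 h2
    have h5 : ((i : ℕ) : ℝ) < (j : ℕ) + 1 := by linarith
    have h6 : ((j : ℕ) : ℝ) < (i : ℕ) + 1 := by linarith
    have h7 : (i : ℕ) < (j : ℕ) + 1 := by exact_mod_cast h5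
    have h8 : (j : ℕ) < (i : ℕ) + 1 := by exact_mod_cast h6
    exact Fin.ext (by omega)
  refine h γ (fun j => ?_) hinj ?_
  · rw [← ht, Complex.norm_real, Real.norm_eq_abs]
    have h0 : (0 : ℝ) ≤ (j : ℕ) := Nat.cast_nonneg _
    rw [abs_of_pos (by linarith [ht1 j])]
    linarith [ht1 j]
  · rw [eval_vdm]
    exact Matrix.det_vandermonde_ne_zero_iff.2 hinj

theorem vdm_ne_zero (m : ℕ) : vdm m ≠ 0 := by
  rw [vdm]
  exact Matrix.det_vandermonde_ne_zero_iff.2 (MvPolynomial.X_injective)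

theorem rename_meanCp {n m : ℕ} (r : ℕ) (σ : Equiv.Perm (Fin m)) :
    MvPolynomial.rename σ (meanCp n m r) = meanCp n m r := by
  refine MvPolynomial.funext fun γ => ?_
  rw [MvPolynomial.eval_rename, eval_meanCp, eval_meanCp]
  congr 1
  ext u
  simp only [detProd, Function.comp_apply]
  congr 1
  exact Equiv.prod_comp σ fun j => (γ j • (1 : Matrix (Fin n) (Fin n) ℂ) - u.1).det

theorem rename_vdm {m : ℕ} (σ : Equiv.Perm (Fin m)) :
    MvPolynomial.rename σ (vdm m) = ((σ.sign : ℤ) : ℂ) • vdm m := by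
  refine MvPolynomial.funext fun γ => ?_
  rw [MvPolynomial.eval_rename, MvPolynomial.smul_eval, eval_vdm, eval_vdm]
  have := Matrix.det_permute σ (Matrix.vandermonde γ)
  rw [← this]
  rfl

/-- The mean is symmetric and the Vandermonde determinant alternating, so their product is
alternating. -/
theorem coeff_perm {n m : ℕ} (r : ℕ) (σ : Equiv.Perm (Fin m)) (e : Fin m → ℕ) :
    MvPolynomial.coeff (Finsupp.equivFunOnFinite.symm (e ∘ σ)) (vdm m * meanCp n m r)
      = ((σ.sign : ℤ) : ℂ) *
        MvPolynomial.coeff (Finsupp.equivFunOnFinite.symm e) (vdm m * meanCp n m r) := by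
  have h1 : MvPolynomial.rename σ (vdm m * meanCp n m r)
      = ((σ.sign : ℤ) : ℂ) • (vdm m * meanCp n m r) := by
    rw [map_mul, rename_meanCp, rename_vdm, smul_mul_assoc]
  have h2 := MvPolynomial.coeff_rename_mapDomain σ σ.injective (vdm m * meanCp n m r)
    (Finsupp.equivFunOnFinite.symm (e ∘ σ))
  rw [h1, MvPolynomial.coeff_smul, smul_eq_mul] at h2
  rw [← h2]
  congr 2
  ext j
  rw [← Finsupp.equivMapDomain_eq_mapDomain]
  simp [Finsupp.equivMapDomain_apply]

theorem degreeOf_vdm_mul_meanCp {n m : ℕ} (r : ℕ) {e : Fin m →₀ ℕ}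
    (he : MvPolynomial.coeff e (vdm m * meanCp n m r) ≠ 0) (j : Fin m) : e j < n + m := by
  have hm : 0 < m := j.pos
  have h1 : MvPolynomial.degreeOf j (vdm m) ≤ m - 1 := by
    rw [vdm_eq_sum]
    refine (MvPolynomial.degreeOf_sum_le _ _ _).trans (Finset.sup_le fun σ _ => ?_)
    refine MvPolynomial.degreeOf_le_iff.2 fun d hd => ?_
    have := Finset.mem_singleton.1 (MvPolynomial.support_monomial_subset hd)
    subst this
    simp
    omega
  have h2 : MvPolynomial.degreeOf j (meanCp n m r) ≤ n := by
    rw [meanCp]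
    refine (MvPolynomial.degreeOf_sum_le _ _ _).trans (Finset.sup_le fun c hc => ?_)
    rw [MvPolynomial.smul_monomial]
    refine MvPolynomial.degreeOf_le_iff.2 fun d hd => ?_
    have := Finset.mem_singleton.1 (MvPolynomial.support_monomial_subset hd)
    subst this
    have := Finset.mem_range.1 (Fintype.mem_piFinset.1 hc j)
    simp
    omega
  have h3 := MvPolynomial.degreeOf_le_iff.1
    ((MvPolynomial.degreeOf_mul_le j (vdm m) (meanCp n m r)).trans (add_le_add h1 h2)) e
    (MvPolynomial.mem_support_iff.2 he)
  omega

end CUE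

/-! ### Only one orbit of exponents survives -/

open MeasureTheory ProbabilityTheory

namespace CUE

open Matrix

/-- The increasing enumeration of the naturals outside `[r, r + n)`. -/
def gapExp (n m r : ℕ) (i : Fin m) : ℕ := if (i : ℕ) < r then i else i + n

theorem gapExp_injective (n m r : ℕ) : Function.Injective (gapExp n m r) := by
  intro i j h
  unfold gapExp at h
  apply Fin.ext
  split_ifs at h <;> omega

theorem sum_fin_add_split (r k : ℕ) (F : ℕ → ℂ) :
    ∑ i : Fin (r + k), F i = ∑ i ∈ Finset.range r, F i + ∑ i ∈ Finset.range k, F (r + i) := by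
  rw [Fin.sum_univ_eq_sum_range F, Finset.sum_range_add]

theorem sum_comp_gapExp (n k r : ℕ) (F : ℕ → ℂ) :
    ∑ i : Fin (r + k), F (gapExp n (r + k) r i)
      = ∑ i ∈ Finset.range r, F i + ∑ i ∈ Finset.range k, F (r + i + n) := by
  simp only [gapExp]
  rw [sum_fin_add_split r k fun i => F (if i < r then i else i + n)]
  congr 1
  · exact Finset.sum_congr rfl fun i hi => by rw [if_pos (Finset.mem_range.1 hi)]
  · simp

theorem sum_gapExp (n k r : ℕ) :
    ∑ i : Fin (r + k), (gapExp n (r + k) r i : ℂ) = (∑ i : Fin (r + k), ((i : ℕ) : ℂ)) + n * k := by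
  rw [sum_comp_gapExp n k r fun x => (x : ℂ), sum_fin_add_split r k fun x => (x : ℂ)]
  simp [Finset.sum_add_distrib]
  ring

theorem sum_gapExp_sq (n k r : ℕ) :
    ∑ i : Fin (r + k), (gapExp n (r + k) r i : ℂ) ^ 2 = (∑ i : Fin (r + k), ((i : ℕ) : ℂ) ^ 2)
      + 2 * n * ((∑ i : Fin (r + k), ((i : ℕ) : ℂ)) - r * (r - 1) / 2) + n ^ 2 * k := by
  have h : ∑ i ∈ Finset.range r, (i : ℂ) = r * (r - 1) / 2 := by
    induction r with
    | zero => simp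
    | succ r ih => rw [Finset.sum_range_succ, ih]; push_cast; ring
  rw [sum_comp_gapExp n k r fun x => (x : ℂ) ^ 2, sum_fin_add_split r k fun x => (x : ℂ),
    sum_fin_add_split r k fun x => (x : ℂ) ^ 2, h]
  have h2 : ∀ i : ℕ, ((r + i + n : ℕ) : ℂ) ^ 2 = ((r + i : ℕ) : ℂ) ^ 2
      + 2 * n * ((r + i : ℕ) : ℂ) + n ^ 2 := by intro i; push_cast; ring
  simp_rw [h2, Finset.sum_add_distrib, ← Finset.mul_sum]
  simp
  ring

/-- The two power sums determine ∑ φ(e_j) for any quadratic φ. Choosing φ negative exactly on the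
integers of the gap [r, r + n), any exponent lying in the gap would make this sum too small. -/
theorem exists_perm_of_sums {n m r : ℕ} (hr : r ≤ m) {e : Fin m → ℕ} (he : Function.Injective e)
    (hlt : ∀ j, e j < n + m) (h1 : ∑ j, (e j : ℤ) = ∑ j, (gapExp n m r j : ℤ))
    (h2 : ∑ j, (e j : ℤ) ^ 2 = ∑ j, (gapExp n m r j : ℤ) ^ 2) :
    ∃ σ : Equiv.Perm (Fin m), e = gapExp n m r ∘ σ := by
  -- The roots are r - 1/2 and r + n - 1/2, so φ is nonzero on integers and changes sign just
  -- outside the gap; the factor 4 clears denominators.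
  set φ : ℕ → ℤ := fun x => (2 * x - 2 * r + 1) * (2 * x - 2 * n - 2 * r + 1) with hφ
  have hexp : ∀ f : Fin m → ℕ, ∑ j, φ (f j) = 4 * (∑ j, (f j : ℤ) ^ 2)
      + (4 - 4 * n - 8 * r) * (∑ j, (f j : ℤ)) + m * ((1 - 2 * r) * (1 - 2 * n - 2 * r)) := by
    intro f
    have : ∀ j, φ (f j) = 4 * (f j : ℤ) ^ 2 + (4 - 4 * n - 8 * r) * (f j : ℤ)
        + (1 - 2 * r) * (1 - 2 * n - 2 * r) := by intro j; simp only [hφ]; ring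
    simp_rw [this, Finset.sum_add_distrib, ← Finset.mul_sum]
    rw [Finset.sum_const, Finset.card_univ, Fintype.card_fin, nsmul_eq_mul]
    ring
  have hsum : ∑ x ∈ Finset.univ.image e, φ x = ∑ x ∈ Finset.univ.image (gapExp n m r), φ x := by
    rw [Finset.sum_image he.injOn, Finset.sum_image (gapExp_injective n m r).injOn, hexp, hexp,
      h1, h2]
  set S := Finset.univ.image e
  set G := Finset.univ.image (gapExp n m r) with hG
  have hmem : ∀ x ∈ S \ G, φ x < 0 := by
    intro x hx
    obtain ⟨hxS, hxG⟩ := Finset.mem_sdiff.1 hx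
    obtain ⟨j, -, rfl⟩ := Finset.mem_image.1 hxS
    have hlo : r ≤ e j := by
      by_contra hc
      exact hxG (Finset.mem_image.2 ⟨⟨e j, by omega⟩, Finset.mem_univ _, by
        simp [gapExp, not_le.1 hc]⟩)
    have hhi : e j < r + n := by
      by_contra hc
      have := hlt j
      exact hxG (Finset.mem_image.2 ⟨⟨e j - n, by omega⟩, Finset.mem_univ _, by
        simp only [gapExp]; split_ifs <;> omega⟩)
    have h3 : (0 : ℤ) < 2 * (e j : ℤ) - 2 * r + 1 := by omega
    have h4 : 2 * (e j : ℤ) - 2 * n - 2 * r + 1 < 0 := by omega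
    exact mul_neg_of_pos_of_neg h3 h4
  have hpos : ∀ x ∈ G \ S, 0 ≤ φ x := by
    intro x hx
    obtain ⟨j, -, rfl⟩ := Finset.mem_image.1 (Finset.mem_sdiff.1 hx).1
    simp only [hφ, gapExp]
    split_ifs with h
    · exact mul_nonneg_of_nonpos_of_nonpos (by omega) (by omega)
    · exact mul_nonneg (by push_cast; omega) (by push_cast; omega)
  have hsub : S ⊆ G := by
    by_contra hc
    have hne : (S \ G).Nonempty := Finset.sdiff_nonempty.2 hc
    have e1 := Finset.sum_inter_add_sum_sdiff S G φ
    have e2 := Finset.sum_inter_add_sum_sdiff G S φ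
    rw [Finset.inter_comm] at e2
    have e3 := Finset.sum_neg hmem hne
    have e4 := Finset.sum_nonneg hpos
    linarith
  have hex : ∀ j, ∃ i, gapExp n m r i = e j := fun j => by
    simpa [hG] using hsub (Finset.mem_image_of_mem e (Finset.mem_univ j))
  choose σ hσ using hex
  have hσi : Function.Injective σ := fun i j hij => he (by rw [← hσ, ← hσ, hij])
  exact ⟨Equiv.ofBijective σ (Finite.injective_iff_bijective.1 hσi), funext fun j => (hσ j).symm⟩

theorem eulerOp_meanCp (n m r : ℕ) : eulerOp m (vdm m * meanCp n m r)
    = ((∑ i : Fin m, ((i : ℕ) : ℂ)) + n * m - r * n) • (vdm m * meanCp n m r) :=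
  eq_of_eval_eq_generic fun γ hγ _ _ => by
    rw [eval_eulerOp_meanCp r hγ, MvPolynomial.smul_eval]

theorem crossOp_meanCp (n m r : ℕ) : crossOp m (vdm m * meanCp n m r)
    = ((∑ i : Fin m, ((i : ℕ) : ℂ)) ^ 2 - ∑ i : Fin m, ((i : ℕ) : ℂ) ^ 2
          + 2 * n * (m - 1) * (∑ i : Fin m, ((i : ℕ) : ℂ)) + m * (m - 1) * n ^ 2
          - r * n * (2 * (∑ i : Fin m, ((i : ℕ) : ℂ)) + 2 * n * (m - 1))
          + r * (r - 1) * (n ^ 2 + n)) • (vdm m * meanCp n m r) :=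
  eq_of_eval_eq_generic fun γ hγ hinj hV => by
    rw [eval_crossOp_meanCp r hγ hinj hV, MvPolynomial.smul_eval]

theorem exists_perm_of_coeff_ne_zero {n m r : ℕ} (hr : r ≤ m) {e : Fin m → ℕ}
    (he : MvPolynomial.coeff (Finsupp.equivFunOnFinite.symm e) (vdm m * meanCp n m r) ≠ 0) :
    ∃ σ : Equiv.Perm (Fin m), e = gapExp n m r ∘ σ := by
  obtain ⟨k, rfl⟩ := Nat.exists_eq_add_of_le hr
  -- Two equal exponents would make the coefficient its own opposite.
  have hinj : Function.Injective e := by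
    intro i j hij
    by_contra hne
    have hs := coeff_perm (n := n) r (Equiv.swap i j) e
    have hes : e ∘ Equiv.swap i j = e := by
      ext l
      simp only [Function.comp_apply, Equiv.swap_apply_def]
      split_ifs with h1 h2
      · rw [h1, hij]
      · rw [h2, hij]
      · rfl
    rw [hes, Equiv.Perm.sign_swap hne] at hs
    apply he
    simp only [Units.val_neg, Units.val_one, Int.cast_neg, Int.cast_one] at hs
    linear_combination hs / 2
  have h1 := coeff_of_diagonal (eulerOp (r + k)) _ eulerOp_monomial (vdm (r + k) * meanCp n (r + k) r)
    (Finsupp.equivFunOnFinite.symm e)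
  rw [eulerOp_meanCp, MvPolynomial.coeff_smul, smul_eq_mul] at h1
  have h1 := mul_right_cancel₀ he h1
  have h2 := coeff_of_diagonal (crossOp (r + k)) _ crossOp_monomial
    (vdm (r + k) * meanCp n (r + k) r) (Finsupp.equivFunOnFinite.symm e)
  rw [crossOp_meanCp, MvPolynomial.coeff_smul, smul_eq_mul] at h2
  have h2 := mul_right_cancel₀ he h2
  rw [offSum_mul] at h2
  simp only [Finsupp.equivFunOnFinite_symm_apply_apply] at h1 h2
  have s1 : ∑ j, (e j : ℂ) = ∑ j, (gapExp n (r + k) r j : ℂ) := by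
    rw [sum_gapExp, ← h1]
    push_cast; ring
  have s2 : ∑ j, (e j : ℂ) ^ 2 = ∑ j, (gapExp n (r + k) r j : ℂ) ^ 2 := by
    rw [sum_gapExp_sq]
    simp_rw [sq (e _ : ℂ)]
    rw [← h1] at h2
    push_cast at h2
    linear_combination h2
  refine exists_perm_of_sums hr hinj (fun j => degreeOf_vdm_mul_meanCp r he j) ?_ ?_
  · exact_mod_cast s1
  · exact_mod_cast s2

/-- The alternant with exponents `gapExp`. -/
noncomputable def gapAlt (n m r : ℕ) : MvPolynomial (Fin m) ℂ :=
  (Matrix.of fun i j : Fin m => (MvPolynomial.X j : MvPolynomial (Fin m) ℂ) ^ gapExp n m r i).det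

theorem gapAlt_eq_sum (n m r : ℕ) : gapAlt n m r = ∑ σ : Equiv.Perm (Fin m),
    MvPolynomial.monomial (Finsupp.equivFunOnFinite.symm (gapExp n m r ∘ σ))
      ((σ.sign : ℤ) : ℂ) := by
  rw [gapAlt, Matrix.det_apply]
  refine Finset.sum_congr rfl fun σ _ => ?_
  have h : ∏ i, (Matrix.of fun i j : Fin m =>
      (MvPolynomial.X j : MvPolynomial (Fin m) ℂ) ^ gapExp n m r i) (σ i) i
      = MvPolynomial.monomial (Finsupp.equivFunOnFinite.symm (gapExp n m r ∘ σ)) 1 := by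
    rw [MvPolynomial.monomial_eq, Finsupp.prod_fintype _ _ (by simp), map_one, one_mul]
    rfl
  rw [h, Units.smul_def, ← Int.cast_smul_eq_zsmul ℂ, MvPolynomial.smul_monomial, smul_eq_mul,
    mul_one]

/-- An alternating polynomial whose exponents form a single orbit is determined by one coefficient.
-/
theorem vdm_mul_meanCp_eq {n m r : ℕ} (hr : r ≤ m) :
    ∃ κ : ℂ, vdm m * meanCp n m r = κ • gapAlt n m r := by
  refine ⟨MvPolynomial.coeff (Finsupp.equivFunOnFinite.symm (gapExp n m r)) (vdm m * meanCp n m r),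
    MvPolynomial.ext _ _ fun d => ?_⟩
  obtain ⟨e, rfl⟩ := Finsupp.equivFunOnFinite.symm.surjective d
  rw [MvPolynomial.coeff_smul, gapAlt_eq_sum, MvPolynomial.coeff_sum, smul_eq_mul]
  simp only [MvPolynomial.coeff_monomial, EmbeddingLike.apply_eq_iff_eq]
  by_cases h : ∃ σ : Equiv.Perm (Fin m), e = gapExp n m r ∘ σ
  · obtain ⟨σ, rfl⟩ := h
    rw [coeff_perm, Finset.sum_eq_single σ]
    · simp [mul_comm]
    · intro τ _ hτ
      rw [if_neg]
      intro h
      exact hτ (Equiv.ext fun i => gapExp_injective n m r (congrFun h i))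
    · simp
  · rw [Finset.sum_eq_zero, mul_zero]
    · by_contra hc
      exact h (exists_perm_of_coeff_ne_zero hr hc)
    · intro τ _
      exact if_neg fun hτ => h ⟨τ, hτ.symm⟩

end CUE

/-! ### Determinants of linear functionals on polynomials -/

open MeasureTheory ProbabilityTheory

namespace CUE

open Matrix Polynomial

section Determinants

variable {R : Type*} [CommRing R] {m n : ℕ}

/-- The matrix of the values of linear functionals on the monomials `X^0, …, X^(m+n-1)`. -/
noncomputable def monomialMatrix (L : Fin m ⊕ Fin n → R[X] →ₗ[R] R) :
    Matrix (Fin m ⊕ Fin n) (Fin m ⊕ Fin n) R :=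
  Matrix.of fun i y => L i (X ^ (finSumFinEquiv y : ℕ))

theorem linear_eq_sum_coeff (l : R[X] →ₗ[R] R) {p : R[X]} (hp : p.degree < (m + n : ℕ)) :
    l p = ∑ y : Fin m ⊕ Fin n, l (X ^ (finSumFinEquiv y : ℕ)) * p.coeff (finSumFinEquiv y : ℕ) := by
  have h : p = ∑ k : Fin (m + n), p.coeff k • X ^ (k : ℕ) := by
    rw [Fin.sum_univ_eq_sum_range fun k => p.coeff k • (X : R[X]) ^ k]
    simp_rw [Polynomial.smul_eq_C_mul]
    by_cases h0 : p = 0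
    · simp [h0]
    · exact Polynomial.as_sum_range_C_mul_X_pow' p ((Polynomial.natDegree_lt_iff_degree_lt h0).2 hp)
  conv_lhs => rw [h]
  rw [map_sum, ← Equiv.sum_comp finSumFinEquiv]
  exact Finset.sum_congr rfl fun y _ => by rw [map_smul, smul_eq_mul, mul_comm]

/-- Change of basis from monomials of degree < m + n to Q_c, X^p a. The transition matrix is block
triangular: the Q_c have degree < m, and a being monic of degree m makes the lower right block
unitriangular. -/
theorem det_functionals_eq (L : Fin m ⊕ Fin n → R[X] →ₗ[R] R) {a : R[X]} (ha : a.Monic)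
    (had : a.natDegree = m) (Q : Fin m → R[X]) (hQ : ∀ c, (Q c).degree < m) :
    (Matrix.of fun i x => L i (Sum.elim Q (fun p : Fin n => X ^ (p : ℕ) * a) x)).det
      = (monomialMatrix L).det * (Matrix.of fun c' c : Fin m => (Q c).coeff c').det := by
  nontriviality R
  set P : Fin m ⊕ Fin n → R[X] := Sum.elim Q (fun p : Fin n => X ^ (p : ℕ) * a) with hP
  have hX : ∀ p : ℕ, (X ^ p * a).natDegree = p + m := by
    intro p
    rw [(monic_X_pow p).natDegree_mul ha, natDegree_X_pow, had]
  have hdeg : ∀ x, (P x).degree < (m + n : ℕ) := by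
    rintro (c | p)
    · exact (hQ c).trans_le (by exact_mod_cast Nat.le_add_right m n)
    · refine degree_le_natDegree.trans_lt ?_
      simp only [hP, Sum.elim_inr, hX]
      exact_mod_cast (by omega : (p : ℕ) + m < m + n)
  have hmul : (Matrix.of fun i x => L i (P x)) = monomialMatrix L *
      (Matrix.of fun y x => (P x).coeff (finSumFinEquiv y : ℕ)) := by
    ext i x
    simp only [Matrix.of_apply, Matrix.mul_apply, monomialMatrix]
    exact linear_eq_sum_coeff (L i) (hdeg x)
  have hblock : (Matrix.of fun y x => (P x).coeff (finSumFinEquiv y : ℕ))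
      = Matrix.fromBlocks (Matrix.of fun c' c : Fin m => (Q c).coeff c')
        (Matrix.of fun (c : Fin m) (p : Fin n) => (X ^ (p : ℕ) * a).coeff c) 0
        (Matrix.of fun p' p : Fin n => (X ^ (p : ℕ) * a).coeff (m + p')) := by
    ext (c' | p') (c | p)
    · simp [hP]
    · simp [hP]
    · simp only [hP, Matrix.of_apply, Sum.elim_inl, Matrix.fromBlocks_apply₂₁, Matrix.zero_apply]
      refine coeff_eq_zero_of_degree_lt ((hQ c).trans_le ?_)
      rw [finSumFinEquiv_apply_right, Fin.val_natAdd]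
      exact_mod_cast Nat.le_add_right m p'
    · simp [hP]
  have htri : (Matrix.of fun p' p : Fin n => (X ^ (p : ℕ) * a).coeff (m + p')).det = 1 := by
    rw [Matrix.det_of_isUpperTriangular]
    · refine Finset.prod_eq_one fun p _ => ?_
      rw [Matrix.of_apply, show m + (p : ℕ) = (X ^ (p : ℕ) * a).natDegree by rw [hX, add_comm]]
      exact ((monic_X_pow _).mul ha).coeff_natDegree
    · intro i j hij
      rw [Matrix.of_apply, coeff_eq_zero_of_natDegree_lt]
      rw [hX]
      have : (j : ℕ) < i := hij
      omega
  rw [hmul, Matrix.det_mul, hblock, Matrix.det_fromBlocks_zero₂₁, htri, mul_one]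

/-- The functionals given by evaluation at points and by a family `μ`. -/
noncomputable def evalFunctionals (γ : Fin m → R) (μ : Fin n → R[X] →ₗ[R] R) :
    Fin m ⊕ Fin n → R[X] →ₗ[R] R :=
  Sum.elim (fun j => Polynomial.leval (γ j)) μ

/-- The basis X^c, X^p ∏ (X - γ_j) is adapted to the evaluations, which annihilate its second half;
the determinant then factors. -/
theorem vandermonde_mul_det_functionals (γ : Fin m → R) (μ : Fin n → R[X] →ₗ[R] R) :
    (Matrix.vandermonde γ).det *
        (Matrix.of fun q p : Fin n => μ q (X ^ (p : ℕ) * ∏ j, (X - C (γ j)))).det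
      = (monomialMatrix (evalFunctionals γ μ)).det := by
  nontriviality R
  have hb : (∏ j, (X - C (γ j))).Monic := monic_prod_of_monic _ _ fun j _ => monic_X_sub_C _
  have hbd : (∏ j, (X - C (γ j))).natDegree = m := by
    rw [natDegree_prod_of_monic _ _ fun j _ => monic_X_sub_C _]
    simp
  have h := det_functionals_eq (evalFunctionals γ μ) hb hbd (fun c => X ^ (c : ℕ)) fun c => by
    rw [degree_X_pow]; exact_mod_cast c.2
  have h1 : (Matrix.of fun c' c : Fin m => ((X : R[X]) ^ (c : ℕ)).coeff c') = 1 := by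
    ext i j
    simp [coeff_X_pow, Matrix.one_apply, Fin.ext_iff]
  rw [h1, Matrix.det_one, mul_one] at h
  rw [← h]
  have hblock : (Matrix.of fun i x => evalFunctionals γ μ i
      (Sum.elim (fun c : Fin m => X ^ (c : ℕ)) (fun p : Fin n => X ^ (p : ℕ) * ∏ j, (X - C (γ j))) x))
      = Matrix.fromBlocks (Matrix.vandermonde γ) 0
        (Matrix.of fun (q : Fin n) (c : Fin m) => μ q (X ^ (c : ℕ)))
        (Matrix.of fun q p : Fin n => μ q (X ^ (p : ℕ) * ∏ j, (X - C (γ j)))) := by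
    ext (i | i) (x | x)
    · simp [evalFunctionals, Matrix.vandermonde_apply]
    · simp only [evalFunctionals, Matrix.of_apply, Sum.elim_inl, Sum.elim_inr,
        Matrix.fromBlocks_apply₁₂, Matrix.zero_apply, leval_apply, eval_mul, eval_prod]
      rw [Finset.prod_eq_zero (Finset.mem_univ i) (by simp), mul_zero]
    · simp [evalFunctionals]
    · simp [evalFunctionals]
  rw [hblock, Matrix.det_fromBlocks_zero₁₂]

end Determinants

/-- With coefficient extraction at r + q as functionals, the monomial matrix has unit rows supported
on the gap columns. Expanding along them leaves the alternant on the complementary exponents, while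
`vandermonde_mul_det_functionals` evaluates the same determinant as Vandermonde times Toeplitz. -/
theorem exists_vdm_mul_det_eq {n m r : ℕ} (hr : r ≤ m) : ∃ ε : ℂ, gapAlt n m r
    = ε • (vdm m * (Matrix.of fun q p : Fin n =>
        (X ^ (p : ℕ) * ∏ j : Fin m, (X - C (MvPolynomial.X j : MvPolynomial (Fin m) ℂ))).coeff
          (r + q)).det) := by
  set L := evalFunctionals (fun j : Fin m => (MvPolynomial.X j : MvPolynomial (Fin m) ℂ))
    (fun q : Fin n => Polynomial.lcoeff (MvPolynomial (Fin m) ℂ) (r + q)) with hL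
  have h := vandermonde_mul_det_functionals
    (fun j : Fin m => (MvPolynomial.X j : MvPolynomial (Fin m) ℂ))
    (fun q : Fin n => Polynomial.lcoeff (MvPolynomial (Fin m) ℂ) (r + q))
  simp only [lcoeff_apply] at h
  rw [vdm, h, ← hL]
  -- Reordering of the columns that puts the exponents outside the gap before those inside it; its
  -- signature is the sign ε.
  set f : Fin m ⊕ Fin n → Fin (m + n) := Sum.elim
    (fun i => ⟨gapExp n m r i, by unfold gapExp; split_ifs <;> omega⟩)
    (fun q => ⟨r + q, by omega⟩) with hf
  have hfi : Function.Injective f := by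
    rintro (i | i) (j | j) hij <;> simp only [hf, Sum.elim_inl, Sum.elim_inr, Fin.mk.injEq] at hij
    · rw [gapExp_injective n m r hij]
    · unfold gapExp at hij; split_ifs at hij <;> omega
    · unfold gapExp at hij; split_ifs at hij <;> omega
    · congr 1; apply Fin.ext; omega
  have hfb : Function.Bijective f := (Fintype.bijective_iff_injective_and_card f).2 ⟨hfi, by simp⟩
  set τ : Equiv.Perm (Fin m ⊕ Fin n) := (Equiv.ofBijective f hfb).trans finSumFinEquiv.symm with hτ
  have hτf : ∀ x, finSumFinEquiv (τ x) = f x := fun x => by simp [hτ]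
  have hblock : (monomialMatrix L).submatrix id τ = Matrix.fromBlocks
      (Matrix.of fun i j : Fin m =>
        (MvPolynomial.X j : MvPolynomial (Fin m) ℂ) ^ gapExp n m r i)ᵀ
      (Matrix.of fun (j : Fin m) (q : Fin n) =>
        (MvPolynomial.X j : MvPolynomial (Fin m) ℂ) ^ (r + (q : ℕ))) 0 1 := by
    ext1 i x
    rcases i with i | i <;> rcases x with x | x <;>
      simp only [Matrix.submatrix_apply, id, monomialMatrix, Matrix.of_apply, hτf, hL,
        evalFunctionals, Sum.elim_inl, Sum.elim_inr, hf, leval_apply, eval_pow, eval_X,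
        Matrix.fromBlocks_apply₁₁, Matrix.fromBlocks_apply₁₂, Matrix.fromBlocks_apply₂₁,
        Matrix.fromBlocks_apply₂₂, Matrix.transpose_apply, lcoeff_apply, coeff_X_pow,
        Matrix.zero_apply, Matrix.one_apply]
    · rw [if_neg]
      unfold gapExp; split_ifs <;> omega
    · simp [Fin.ext_iff]
  have hdet := Matrix.det_permute' τ (monomialMatrix L)
  rw [hblock, Matrix.det_fromBlocks_zero₂₁, Matrix.det_one, mul_one, Matrix.det_transpose] at hdet
  refine ⟨((τ.sign : ℤ) : ℂ), ?_⟩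
  rw [gapAlt, hdet, MvPolynomial.smul_eq_C_mul]
  simp

end CUE

/-! ### The Heine–Szegő formula for Laurent polynomials -/

open MeasureTheory ProbabilityTheory

namespace CUE

open Matrix Polynomial

/-- The Toeplitz determinant of the Laurent polynomial `X^{-r} b`. -/
noncomputable def toepDet (n r : ℕ) (b : ℂ[X]) : ℂ :=
  (Matrix.of fun q p : Fin n => (X ^ (p : ℕ) * b).coeff (r + q)).det

/-- Cancelling the Vandermonde determinant in the polynomial ring gives one constant valid for all
γ, coincident points and points of the circle included. -/
theorem exists_integral_detProd_eq {n m r : ℕ} (hr : r ≤ m) : ∃ κ : ℂ, ∀ γ : Fin m → ℂ,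
    ∫ u : U n, detProd r γ u ∂haar n = κ * toepDet n r (∏ j, (X - C (γ j))) := by
  obtain ⟨κ, hκ⟩ := vdm_mul_meanCp_eq (n := n) hr
  obtain ⟨ε, hε⟩ := exists_vdm_mul_det_eq (n := n) hr
  rw [hε, smul_smul, ← mul_smul_comm] at hκ
  have h := mul_left_cancel₀ (vdm_ne_zero m) hκ
  refine ⟨κ * ε, fun γ => ?_⟩
  rw [← eval_meanCp, h, MvPolynomial.smul_eval, RingHom.map_det, toepDet]
  congr 2
  ext q p
  simp only [RingHom.mapMatrix_apply, Matrix.map_apply, Matrix.of_apply]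
  rw [← Polynomial.coeff_map]
  simp [Polynomial.map_prod]

theorem exists_eq_prod_X_sub_C {m : ℕ} {b : ℂ[X]} (hb : b.Monic) (hbd : b.natDegree = m) :
    ∃ γ : Fin m → ℂ, b = ∏ j, (X - C (γ j)) := by
  have hs := IsAlgClosed.splits b
  have hcard : b.roots.toList.length = m := by
    rw [Multiset.length_toList, ← hbd, hs.natDegree_eq_card_roots]
  have h1 := hs.eq_prod_roots
  rw [hb.leadingCoeff, C_1, one_mul, ← Multiset.coe_toList b.roots, Multiset.map_coe,
    Multiset.prod_coe, ← Fin.prod_univ_fun_getElem] at h1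
  subst hcard
  exact ⟨fun j => b.roots.toList[j.1], h1⟩

theorem prod_det_sub_eq {n m : ℕ} (γ : Fin m → ℂ) (A : Matrix (Fin n) (Fin n) ℂ) :
    ∏ j, (γ j • (1 : Matrix (Fin n) (Fin n) ℂ) - A).det
      = ((-1) ^ n) ^ m * (aeval A (∏ j, (X - C (γ j)))).det := by
  have h : ∀ j, (γ j • (1 : Matrix (Fin n) (Fin n) ℂ) - A).det
      = (-1) ^ n * (aeval A (X - C (γ j))).det := by
    intro j
    rw [← neg_sub, Matrix.det_neg, Fintype.card_fin]
    simp [Matrix.algebraMap_eq_diagonal, Matrix.smul_one_eq_diagonal]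
    rfl
  have h2 : (aeval A (∏ j, (X - C (γ j)))).det = ∏ j, (aeval A (X - C (γ j))).det := by
    have := map_prod ((Matrix.detMonoidHom (n := Fin n) (R := ℂ)).comp
      ((aeval A : ℂ[X] →ₐ[ℂ] Matrix (Fin n) (Fin n) ℂ) : ℂ[X] →* Matrix (Fin n) (Fin n) ℂ))
      (fun j => X - C (γ j)) Finset.univ
    exact this
  rw [h2, Finset.prod_congr rfl fun j _ => h j, Finset.prod_mul_distrib]
  simp

/-- The symbol 1 + X^s gives a lower triangular band matrix with unit diagonal. -/
theorem toepDet_one_add {n r s : ℕ} (hs : s ≠ 0) : toepDet n r (X ^ r * (1 + X ^ s)) = 1 := by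
  have h : ∀ q p : Fin n, (X ^ (p : ℕ) * (X ^ r * (1 + X ^ s)) : ℂ[X]).coeff (r + q)
      = (if (q : ℕ) = p then 1 else 0) + if (q : ℕ) = p + s then 1 else 0 := by
    intro q p
    have : (X ^ (p : ℕ) * (X ^ r * (1 + X ^ s)) : ℂ[X]) = X ^ (r + p) + X ^ (r + (p + s)) := by ring
    rw [this, coeff_add, coeff_X_pow, coeff_X_pow]
    simp
  rw [toepDet, Matrix.det_of_isLowerTriangular]
  · refine Finset.prod_eq_one fun p _ => ?_
    rw [Matrix.of_apply, h]
    simp [hs]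
  · intro i j hij
    rw [Matrix.of_apply, h]
    have : (i : ℕ) < j := hij
    rw [if_neg (by omega), if_neg (by omega), add_zero]

theorem toepDet_X_pow {n r : ℕ} : toepDet n r (X ^ r) = 1 := by
  rw [toepDet, ← Matrix.det_one (n := Fin n) (R := ℂ)]
  congr 1
  ext q p
  rw [Matrix.of_apply, ← pow_add, coeff_X_pow, Matrix.one_apply]
  simp [Fin.ext_iff, add_comm]

theorem toepDet_C_mul {n r : ℕ} (c : ℂ) (b : ℂ[X]) :
    toepDet n r (C c * b) = c ^ n * toepDet n r b := by
  have h : (Matrix.of fun q p : Fin n => (X ^ (p : ℕ) * (C c * b)).coeff (r + q))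
      = c • Matrix.of fun q p : Fin n => (X ^ (p : ℕ) * b).coeff (r + q) := by
    ext q p
    rw [Matrix.of_apply, mul_left_comm, coeff_C_mul]
    simp
  rw [toepDet, toepDet, h, Matrix.det_smul, Fintype.card_fin]

/-- The constant κ depends only on n, m, r, so a single monic b of degree m for which both sides are
known suffices. -/
theorem integral_det_aeval_monic {n m r : ℕ} (hr : r ≤ m) {b : ℂ[X]} (hb : b.Monic)
    (hbd : b.natDegree = m) :
    ∫ u : U n, (u.1.det ^ r)⁻¹ * (aeval u.1 b).det ∂haar n = toepDet n r b := by
  obtain ⟨κ, hκ⟩ := exists_integral_detProd_eq (n := n) hr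
  have key : ∀ b : ℂ[X], b.Monic → b.natDegree = m →
      ((-1) ^ n) ^ m * ∫ u : U n, (u.1.det ^ r)⁻¹ * (aeval u.1 b).det ∂haar n
        = κ * toepDet n r b := by
    intro b hb hbd
    obtain ⟨γ, rfl⟩ := exists_eq_prod_X_sub_C hb hbd
    rw [← hκ, ← integral_const_mul]
    congr 1
    ext u
    rw [detProd, prod_det_sub_eq]
    ring
  have hdet : ∀ u : U n, (u.1.det ^ r)⁻¹ * (u.1 ^ r).det = 1 := fun u => by
    rw [Matrix.det_pow, inv_mul_cancel₀ (pow_ne_zero _ (det_coeU_ne_zero u))]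
  -- Test polynomial: X^r if m = r, and X^r (1 + X^s) if m = r + s with s > 0; both sides equal 1.
  -- The sign accounts for det(γ - u) = (-1)^n det(u - γ).
  have hκ1 : ((-1 : ℂ) ^ n) ^ m = κ := by
    obtain ⟨s, rfl⟩ := Nat.exists_eq_add_of_le hr
    by_cases hs : s = 0
    · subst hs
      have := key (X ^ r) (monic_X_pow r) (by simp)
      rw [toepDet_X_pow, mul_one] at this
      rw [← this]
      simp only [map_pow, aeval_X, hdet]
      simp
    · have hm : (1 + X ^ s : ℂ[X]).Monic := by
        rw [add_comm]; exact monic_X_pow_add_C (1 : ℂ) hs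
      have hd : (X ^ r * (1 + X ^ s) : ℂ[X]).natDegree = r + s := by
        rw [(monic_X_pow r).natDegree_mul hm, natDegree_X_pow, add_comm, ← C_1,
          add_comm _ (X ^ s), natDegree_X_pow_add_C, add_comm]
      have := key _ ((monic_X_pow r).mul hm) hd
      rw [toepDet_one_add hs, mul_one] at this
      rw [← this]
      simp only [map_mul, map_add, map_one, map_pow, aeval_X, Matrix.det_mul, ← mul_assoc,
        hdet, one_mul]
      rw [integral_det_one_add_pow hs, mul_one]
  have := key b hb hbd
  rw [← hκ1] at this
  exact mul_left_cancel₀ (pow_ne_zero _ (pow_ne_zero _ (by norm_num))) this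

/-- Both sides are homogeneous of degree n in b, which reduces to the monic case. -/
theorem integral_det_aeval {n r : ℕ} {b : ℂ[X]} (hb : b ≠ 0) (hr : r ≤ b.natDegree) :
    ∫ u : U n, (u.1.det ^ r)⁻¹ * (aeval u.1 b).det ∂haar n = toepDet n r b := by
  have hc : b.leadingCoeff ≠ 0 := leadingCoeff_ne_zero.2 hb
  set b' := C b.leadingCoeff⁻¹ * b with hb'
  have hbb : b = C b.leadingCoeff * b' := by
    rw [hb', ← mul_assoc, ← C_mul, mul_inv_cancel₀ hc, C_1, one_mul]
  have hm : b'.Monic := by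
    rw [hb', Monic, leadingCoeff_mul, leadingCoeff_C, inv_mul_cancel₀ hc]
  have hd : b'.natDegree = b.natDegree := by
    rw [hb', natDegree_C_mul (inv_ne_zero hc)]
  have h := integral_det_aeval_monic (n := n) hr hm hd
  conv_rhs => rw [hbb, toepDet_C_mul, ← h, ← integral_const_mul]
  congr 1
  ext u
  conv_lhs => rw [hbb, map_mul, aeval_C, Matrix.det_mul, Matrix.algebraMap_eq_diagonal,
    Matrix.det_diagonal]
  simp
  ring

end CUE

/-! ### Fourier coefficients on the circle, realized as U(1) -/

open MeasureTheory ProbabilityTheory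

namespace CUE

open Matrix Polynomial Filter Topology

section CircleIntegrals

theorem norm_det_coeU {n : ℕ} (u : U n) : ‖u.1.det‖ = 1 := by
  have h := Matrix.det_of_mem_unitary u.2
  have h1 : star u.1.det * u.1.det = 1 := (Unitary.mem_iff.1 h).1
  have h2 : ‖u.1.det‖ * ‖u.1.det‖ = 1 := by simpa using congrArg norm h1
  nlinarith [norm_nonneg u.1.det]

theorem continuous_det_zpow {n : ℕ} (k : ℤ) : Continuous fun u : U n => u.1.det ^ k :=
  (continuous_coeU.matrix_det).zpow₀ k fun u => Or.inl (det_coeU_ne_zero u)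

/-- Rotation by e^{iπ/k} changes the sign of the integrand. -/
theorem integral_det_zpow {k : ℤ} (hk : k ≠ 0) : ∫ u : U 1, u.1.det ^ k ∂haar 1 = 0 := by
  set ζ : ℂ := Complex.exp (((Real.pi / k : ℝ) : ℂ) * Complex.I) with hζ
  have hζ1 : ‖ζ‖ = 1 := Complex.norm_exp_ofReal_mul_I _
  have hζk : ζ ^ k = -1 := by
    rw [hζ, ← Complex.exp_int_mul, ← Complex.exp_pi_mul_I]
    congr 1
    have : (k : ℂ) ≠ 0 := by exact_mod_cast hk
    push_cast
    field_simp
  have h := integral_haar_mul_left (fun u : U 1 => u.1.det ^ k) (scalarU 1 ζ hζ1)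
  simp_rw [coe_scalarU_mul, Matrix.det_smul, Fintype.card_fin, pow_one, mul_zpow, hζk] at h
  rw [integral_const_mul] at h
  linear_combination (-1 / 2) * h

theorem integral_det_zpow_mul_eval (P : ℂ[X]) (t : ℕ) :
    ∫ u : U 1, u.1.det ^ (-(t : ℤ)) * P.eval u.1.det ∂haar 1 = P.coeff t := by
  have hi : ∀ i ∈ P.support, Integrable
      (fun u : U 1 => P.coeff i * u.1.det ^ ((i : ℤ) - t)) (haar 1) :=
    fun i _ => (integrable_haar (continuous_det_zpow _)).const_mul _
  have h : ∀ u : U 1, u.1.det ^ (-(t : ℤ)) * P.eval u.1.det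
      = ∑ i ∈ P.support, P.coeff i * u.1.det ^ ((i : ℤ) - t) := by
    intro u
    rw [eval_eq_sum, Polynomial.sum, Finset.mul_sum]
    refine Finset.sum_congr rfl fun i _ => ?_
    rw [sub_eq_add_neg, zpow_add₀ (det_coeU_ne_zero u), zpow_natCast]
    ring
  simp_rw [h]
  rw [integral_finsetSum _ hi]
  simp_rw [integral_const_mul]
  rw [Finset.sum_eq_single t]
  · simp
  · intro i _ hit
    rw [integral_det_zpow (by omega), mul_zero]
  · intro ht
    rw [notMem_support_iff.1 ht, zero_mul]

theorem det_sub_ne_zero {α : ℂ} (hα : ‖α‖ ≠ 1) (u : U 1) : u.1.det - α ≠ 0 := by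
  intro h
  rw [sub_eq_zero] at h
  exact hα (h ▸ norm_det_coeU u)

theorem continuous_det_zpow_div {α : ℂ} (hα : ‖α‖ ≠ 1) (q : ℤ) :
    Continuous fun u : U 1 => u.1.det ^ q / (u.1.det - α) :=
  (continuous_det_zpow q).div (continuous_coeU.matrix_det.sub continuous_const)
    fun u => det_sub_ne_zero hα u

/-- The integral of `x^q / (x - α)` over the unit circle. -/
noncomputable def circInt (α : ℂ) (q : ℤ) : ℂ := ∫ u : U 1, u.1.det ^ q / (u.1.det - α) ∂haar 1

theorem circInt_add_one {α : ℂ} (hα : ‖α‖ ≠ 1) (q : ℤ) :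
    circInt α (q + 1) = α * circInt α q + if q = 0 then 1 else 0 := by
  have h : ∀ u : U 1, u.1.det ^ (q + 1) / (u.1.det - α)
      = α * (u.1.det ^ q / (u.1.det - α)) + u.1.det ^ q := by
    intro u
    have := det_sub_ne_zero hα u
    rw [zpow_add_one₀ (det_coeU_ne_zero u)]
    field_simp
    ring
  unfold circInt
  simp_rw [h]
  rw [integral_add ((integrable_haar (continuous_det_zpow_div hα q)).const_mul _)
    (integrable_haar (continuous_det_zpow q)), integral_const_mul]
  congr 1
  split_ifs with hq
  · subst hq; simp
  · exact integral_det_zpow hq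

theorem norm_circInt_le {α : ℂ} (q : ℤ) :
    ‖circInt α q‖ ≤ ∫ u : U 1, ‖(u.1.det - α)⁻¹‖ ∂haar 1 := by
  refine (norm_integral_le_integral_norm _).trans (le_of_eq ?_)
  congr 1
  ext u
  rw [div_eq_mul_inv, norm_mul, norm_zpow, norm_det_coeU, _root_.one_zpow, one_mul]

/-- Replaces residue calculus: a recurrence with ratio of modulus < 1 and a uniform bound forces the
integral to vanish. -/
theorem eq_zero_of_eq_pow_mul {x a : ℂ} {C : ℝ} (ha : ‖a‖ < 1) (y : ℕ → ℂ)
    (hy : ∀ N, ‖y N‖ ≤ C) (h : ∀ N, x = a ^ N * y N) : x = 0 := by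
  have h1 : Tendsto (fun N => a ^ N * y N) atTop (𝓝 0) := by
    refine squeeze_zero_norm (a := fun N => ‖a‖ ^ N * C) (fun N => ?_) ?_
    · rw [norm_mul, norm_pow]
      exact mul_le_mul_of_nonneg_left (hy N) (by positivity)
    · simpa using (tendsto_pow_atTop_nhds_zero_of_lt_one (norm_nonneg a) ha).mul_const C
  exact tendsto_nhds_unique (tendsto_const_nhds.congr h) h1

theorem circInt_neg_of_norm_lt {α : ℂ} (hα : ‖α‖ < 1) (q : ℕ) : circInt α (-(q : ℤ)) = 0 := by
  refine eq_zero_of_eq_pow_mul hα (fun N => circInt α (-((q + N : ℕ) : ℤ)))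
    (fun N => norm_circInt_le _) fun N => ?_
  induction N with
  | zero => simp
  | succ N ih =>
    rw [ih]
    have := circInt_add_one hα.ne (-((q + (N + 1) : ℕ) : ℤ))
    rw [if_neg (by omega), add_zero,
      show -((q + (N + 1) : ℕ) : ℤ) + 1 = -((q + N : ℕ) : ℤ) by push_cast; ring] at this
    rw [this]; ring

theorem circInt_neg_of_lt_norm {α : ℂ} (hα : 1 < ‖α‖) (q : ℕ) :
    circInt α (-(q : ℤ)) = -(α⁻¹) ^ (q + 1) := by
  have hα0 : α ≠ 0 := by rintro rfl; simp at hα; linarith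
  -- For |α| > 1 the recurrence contracts upwards; the nonzero values below come from the
  -- inhomogeneous term at q = 0.
  have h1 : circInt α 1 = 0 := by
    refine eq_zero_of_eq_pow_mul (a := α⁻¹) (by rw [norm_inv]; exact inv_lt_one_of_one_lt₀ hα)
      (fun N => circInt α (1 + N)) (fun N => norm_circInt_le _) fun N => ?_
    induction N with
    | zero => simp
    | succ N ih =>
      rw [ih]
      have := circInt_add_one hα.ne' (1 + N)
      rw [if_neg (by omega), add_zero] at this
      push_cast
      rw [← add_assoc, this, pow_succ, mul_assoc, inv_mul_cancel_left₀ hα0]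
  induction q with
  | zero =>
    have := circInt_add_one hα.ne' 0
    rw [zero_add, h1, if_pos rfl] at this
    simp
    field_simp
    linear_combination -this
  | succ q ih =>
    have := circInt_add_one hα.ne' (-((q + 1 : ℕ) : ℤ))
    rw [if_neg (by omega), add_zero,
      show -((q + 1 : ℕ) : ℤ) + 1 = -(q : ℤ) by push_cast; ring, ih] at this
    rw [pow_succ]
    field_simp
    field_simp at this
    linear_combination -this

end CircleIntegrals

/-! ### From Laurent polynomials to rational symbols -/

section Approximation

/-- The polynomial `c (X^N - α^N) / (X - α)`, with `c = 1` if `|α| < 1` and `c = -α^{-N}`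
otherwise. -/
noncomputable def geomPoly (α : ℂ) (N : ℕ) : ℂ[X] :=
  C (if ‖α‖ < 1 then 1 else -(α ^ N)⁻¹) * ∑ s ∈ Finset.range N, X ^ s * C α ^ (N - 1 - s)

theorem geomPoly_mul (α : ℂ) (N : ℕ) : geomPoly α N * (X - C α)
    = C (if ‖α‖ < 1 then 1 else -(α ^ N)⁻¹) * (X ^ N - C (α ^ N)) := by
  rw [geomPoly, mul_assoc, (Commute.all (X : ℂ[X]) (C α)).geom_sum₂_mul, C_pow]

/-- The power of the determinant that goes with `geomPoly`. -/
noncomputable def geomExp (α : ℂ) (N : ℕ) : ℕ := if ‖α‖ < 1 then N else 0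

/-- The correction factor of the truncated geometric series. -/
noncomputable def geomErr {n : ℕ} (α : ℂ) (N : ℕ) (u : U n) : ℂ :=
  if ‖α‖ < 1 then (1 - α ^ N • ((u ^ N)⁻¹ : U n).1).det else (1 - (α⁻¹) ^ N • (u ^ N : U n).1).det

theorem det_aeval_mul {n : ℕ} (A : Matrix (Fin n) (Fin n) ℂ) (p q : ℂ[X]) :
    (aeval A (p * q)).det = (aeval A p).det * (aeval A q).det := by
  rw [map_mul, Matrix.det_mul]

theorem det_aeval_prod {n : ℕ} {ι : Type*} (s : Finset ι) (A : Matrix (Fin n) (Fin n) ℂ)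
    (p : ι → ℂ[X]) : (aeval A (∏ i ∈ s, p i)).det = ∏ i ∈ s, (aeval A (p i)).det := by
  classical
  induction s using Finset.induction_on with
  | empty => simp
  | insert a s ha ih => rw [Finset.prod_insert ha, Finset.prod_insert ha, det_aeval_mul, ih]

theorem aeval_X_sub_C {n : ℕ} (A : Matrix (Fin n) (Fin n) ℂ) (c : ℂ) :
    aeval A (X - C c) = A - c • 1 := by
  rw [map_sub, aeval_X, aeval_C, Algebra.algebraMap_eq_smul_one]

theorem det_aeval_X_sub_C_ne_zero {n : ℕ} (u : U n) {α : ℂ} (hα : ‖α‖ ≠ 1) :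
    (aeval u.1 (X - C α)).det ≠ 0 := by
  rw [aeval_X_sub_C, ← neg_sub, Matrix.det_neg]
  exact mul_ne_zero (pow_ne_zero _ (by norm_num)) (det_smul_one_sub_ne_zero u hα)

theorem coe_pow_U {n : ℕ} (u : U n) (N : ℕ) : (u ^ N : U n).1 = u.1 ^ N := rfl

/-- Multiplying by X - α telescopes the geometric sum to a multiple of X^N - α^N. For |α| < 1 the
factor u^N is taken out, for |α| > 1 the scalar -α^N, so that what remains is 1 plus a small term.
-/
theorem det_geomPoly {n : ℕ} {α : ℂ} (hα : ‖α‖ ≠ 1) (N : ℕ) (u : U n) :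
    (u.1.det ^ geomExp α N)⁻¹ * (aeval u.1 (geomPoly α N)).det
      = geomErr α N u / (aeval u.1 (X - C α)).det := by
  rw [eq_div_iff (det_aeval_X_sub_C_ne_zero u hα), mul_assoc, ← det_aeval_mul, geomPoly_mul]
  unfold geomExp geomErr
  split_ifs with h
  · have h1 : aeval u.1 (C 1 * (X ^ N - C (α ^ N)))
        = (u ^ N : U n).1 * (1 - α ^ N • ((u ^ N)⁻¹ : U n).1) := by
      have h2 : (u ^ N : U n).1 * ((u ^ N)⁻¹ : U n).1 = 1 := by
        rw [← Matrix.UnitaryGroup.mul_val, mul_inv_cancel, Matrix.UnitaryGroup.one_val]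
      rw [C_1, one_mul, map_sub, map_pow, aeval_X, aeval_C, Algebra.algebraMap_eq_smul_one, mul_sub,
        mul_one, mul_smul_comm, h2, coe_pow_U]
    rw [h1, Matrix.det_mul, coe_pow_U, Matrix.det_pow, ← mul_assoc,
      inv_mul_cancel₀ (pow_ne_zero _ (det_coeU_ne_zero u)), one_mul]
  · have hα0 : α ≠ 0 := by rintro rfl; simp at h
    rw [pow_zero, inv_one, one_mul]
    congr 1
    rw [map_mul, map_sub, map_pow, aeval_X, aeval_C, aeval_C, Algebra.algebraMap_eq_smul_one,
      Algebra.algebraMap_eq_smul_one, smul_mul_assoc, one_mul, smul_sub, smul_smul, neg_mul,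
      inv_mul_cancel₀ (pow_ne_zero _ hα0), coe_pow_U, inv_pow]
    simp only [neg_smul, one_smul]
    abel

theorem norm_det_one_sub_smul_le {n : ℕ} {x : ℂ} (hx : ‖x‖ ≤ 1) (v : U n) :
    ‖(1 - x • v.1).det‖ ≤ n.factorial * 2 ^ n := by
  have h := Matrix.det_le (A := 1 - x • v.1) (abv := (NormedField.toAbsoluteValue ℂ)) (x := 2)
    fun i j => by
      change ‖(1 - x • v.1) i j‖ ≤ 2
      refine (norm_sub_le _ _).trans ?_
      have h1 : ‖(1 : Matrix (Fin n) (Fin n) ℂ) i j‖ ≤ 1 := by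
        rw [Matrix.one_apply]; split_ifs <;> simp
      have h2 : ‖(x • v.1) i j‖ ≤ 1 := by
        rw [Matrix.smul_apply, norm_smul]
        exact mul_le_one₀ hx (norm_nonneg _) (entry_norm_bound_of_unitary v.2 i j)
      linarith
  have h' : ‖(1 - x • v.1).det‖ ≤
      (Fintype.card (Fin n)).factorial • (2 : ℝ) ^ Fintype.card (Fin n) := h
  simpa using h'

theorem tendsto_det_one_sub_smul {n : ℕ} {x : ℂ} (hx : ‖x‖ < 1) (v : ℕ → U n) :
    Tendsto (fun N => (1 - x ^ N • (v N).1).det) atTop (𝓝 1) := by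
  have h : Tendsto (fun N => 1 - x ^ N • (v N).1) atTop
      (𝓝 (1 : Matrix (Fin n) (Fin n) ℂ)) := by
    refine tendsto_pi_nhds.2 fun i => tendsto_pi_nhds.2 fun j => ?_
    have h0 : Tendsto (fun N => x ^ N * (v N).1 i j) atTop (𝓝 0) := by
      refine squeeze_zero_norm (a := fun N => ‖x‖ ^ N) (fun N => ?_)
        (tendsto_pow_atTop_nhds_zero_of_lt_one (norm_nonneg x) hx)
      rw [norm_mul, norm_pow]
      exact mul_le_of_le_one_right (by positivity) (entry_norm_bound_of_unitary (v N).2 i j)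
    simpa using (tendsto_const_nhds (x := (1 : Matrix (Fin n) (Fin n) ℂ) i j)).sub h0
  have h1 := ((continuous_id.matrix_det).tendsto (1 : Matrix (Fin n) (Fin n) ℂ)).comp h
  rw [id, Matrix.det_one] at h1
  exact h1

theorem norm_geomErr_le {n : ℕ} (α : ℂ) (N : ℕ) (u : U n) :
    ‖geomErr α N u‖ ≤ n.factorial * 2 ^ n := by
  unfold geomErr
  split_ifs with h
  · exact norm_det_one_sub_smul_le (by rw [norm_pow]; exact pow_le_one₀ (norm_nonneg _) h.le) _
  · refine norm_det_one_sub_smul_le ?_ _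
    rw [norm_pow, norm_inv]
    exact pow_le_one₀ (by positivity) (inv_le_one_of_one_le₀ (not_lt.1 h))

theorem tendsto_geomErr {n : ℕ} {α : ℂ} (hα : ‖α‖ ≠ 1) (u : U n) :
    Tendsto (fun N => geomErr α N u) atTop (𝓝 1) := by
  unfold geomErr
  split_ifs with h
  · exact tendsto_det_one_sub_smul h _
  · refine tendsto_det_one_sub_smul ?_ _
    rw [norm_inv]
    exact inv_lt_one_of_one_lt₀ (lt_of_le_of_ne (not_lt.1 h) hα.symm)

variable {k : ℕ}

/-- The Laurent polynomial approximations of `∏ (X - β_j) / (X - α_j)`, up to a power of `X`. -/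
noncomputable def approxPoly (α β : Fin k → ℂ) (N : ℕ) : ℂ[X] :=
  (∏ j, (X - C (β j))) * ∏ i, geomPoly (α i) N

/-- The power of `X` that goes with `approxPoly`. -/
noncomputable def approxExp (α : Fin k → ℂ) (N : ℕ) : ℕ := ∑ i, geomExp (α i) N

/-- Supplies the hypotheses of `integral_det_aeval`. The case N = 0 is excluded because the empty
geometric sum vanishes. -/
theorem approxPoly_ne_zero_and_le {α β : Fin k → ℂ} {N : ℕ} (hN : N ≠ 0) :
    approxPoly α β N ≠ 0 ∧ approxExp α N ≤ (approxPoly α β N).natDegree := by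
  have hbm : (∏ j, (X - C (β j))).Monic := monic_prod_of_monic _ _ fun j _ => monic_X_sub_C _
  have ham : (∏ j, (X - C (α j))).Monic := monic_prod_of_monic _ _ fun j _ => monic_X_sub_C _
  have hdeg : ∀ γ : Fin k → ℂ, (∏ j, (X - C (γ j))).natDegree = k := fun γ => by
    rw [natDegree_prod_of_monic _ _ fun j _ => monic_X_sub_C _]
    simp
  have hc : ∀ i, (if ‖α i‖ < 1 then (1 : ℂ) else -(α i ^ N)⁻¹) ≠ 0 := by
    intro i
    split_ifs with h
    · exact one_ne_zero
    · have : α i ≠ 0 := by intro h0; simp [h0] at h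
      exact neg_ne_zero.2 (inv_ne_zero (pow_ne_zero _ this))
  have hf : ∀ i, C (if ‖α i‖ < 1 then (1 : ℂ) else -(α i ^ N)⁻¹) * (X ^ N - C (α i ^ N)) ≠ 0 :=
    fun i => mul_ne_zero (C_ne_zero.2 (hc i)) (monic_X_pow_sub_C _ hN).ne_zero
  have hmul : approxPoly α β N * ∏ j, (X - C (α j)) = (∏ j, (X - C (β j))) *
      ∏ i, (C (if ‖α i‖ < 1 then (1 : ℂ) else -(α i ^ N)⁻¹) * (X ^ N - C (α i ^ N))) := by
    rw [approxPoly, mul_assoc, ← Finset.prod_mul_distrib]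
    simp_rw [geomPoly_mul]
  have hR : (∏ i, (C (if ‖α i‖ < 1 then (1 : ℂ) else -(α i ^ N)⁻¹) * (X ^ N - C (α i ^ N)))) ≠ 0 :=
    Finset.prod_ne_zero_iff.2 fun i _ => hf i
  have h0 : approxPoly α β N ≠ 0 := by
    intro h
    rw [h, zero_mul] at hmul
    exact mul_ne_zero hbm.ne_zero hR hmul.symm
  refine ⟨h0, ?_⟩
  -- The degrees k of the two products cancel, so the approximation has degree kN, while the
  -- exponent is at most kN.
  have hd := congrArg natDegree hmul
  rw [natDegree_mul h0 ham.ne_zero, natDegree_mul hbm.ne_zero hR, hdeg, hdeg,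
    natDegree_prod _ _ fun i _ => hf i] at hd
  simp_rw [natDegree_C_mul (hc _), natDegree_X_pow_sub_C] at hd
  have hle : approxExp α N ≤ ∑ _i : Fin k, N := Finset.sum_le_sum fun i _ => by
    unfold geomExp; split_ifs <;> omega
  omega

/-- The ratio of products of characteristic polynomials. -/
noncomputable def ratio {n : ℕ} (α β : Fin k → ℂ) (u : U n) : ℂ :=
  (aeval u.1 (∏ j, (X - C (β j)))).det / (aeval u.1 (∏ j, (X - C (α j)))).det

theorem det_aeval_prod_ne_zero {n : ℕ} {α : Fin k → ℂ} (hα : ∀ i, ‖α i‖ ≠ 1) (u : U n) :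
    (aeval u.1 (∏ j, (X - C (α j)))).det ≠ 0 := by
  rw [det_aeval_prod]
  exact Finset.prod_ne_zero_iff.2 fun i _ => det_aeval_X_sub_C_ne_zero u (hα i)

theorem continuous_det_aeval {n : ℕ} (p : ℂ[X]) : Continuous fun u : U n => (aeval u.1 p).det := by
  refine Continuous.matrix_det ?_
  simp_rw [aeval_eq_sum_range]
  exact continuous_finsetSum _ fun i _ => (continuous_coeU.pow i).const_smul (p.coeff i)

theorem continuous_ratio {n : ℕ} {α : Fin k → ℂ} (hα : ∀ i, ‖α i‖ ≠ 1) (β : Fin k → ℂ) :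
    Continuous (ratio (n := n) α β) :=
  (continuous_det_aeval _).div (continuous_det_aeval _) fun u => det_aeval_prod_ne_zero hα u

theorem det_approxPoly {n : ℕ} {α : Fin k → ℂ} (hα : ∀ i, ‖α i‖ ≠ 1) (β : Fin k → ℂ) (N : ℕ)
    (u : U n) : (u.1.det ^ approxExp α N)⁻¹ * (aeval u.1 (approxPoly α β N)).det
      = ratio α β u * ∏ i, geomErr (α i) N u := by
  have h := Finset.prod_congr (rfl : (Finset.univ : Finset (Fin k)) = Finset.univ)
    fun i _ => det_geomPoly (hα i) N u
  rw [Finset.prod_mul_distrib, Finset.prod_inv_distrib, Finset.prod_pow_eq_pow_sum,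
    Finset.prod_div_distrib] at h
  rw [approxPoly, det_aeval_mul, approxExp, mul_left_comm,
    det_aeval_prod (p := fun i => geomPoly (α i) N), h, ratio, det_aeval_prod (p := fun j => X - C (α j))]
  ring

/-- Dominated convergence with the uniform bound n! 2^n on each error factor. The weight w allows
use both on U(n), with w = 1, and on U(1), with powers of the coordinate. -/
theorem tendsto_integral_approx {n : ℕ} {α : Fin k → ℂ} (hα : ∀ i, ‖α i‖ ≠ 1) (β : Fin k → ℂ)
    {w : U n → ℂ} (hw : Continuous w) :
    Tendsto (fun N => ∫ u, w u * ((u.1.det ^ approxExp α N)⁻¹ *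
        (aeval u.1 (approxPoly α β N)).det) ∂haar n) atTop
      (𝓝 (∫ u, w u * ratio α β u ∂haar n)) := by
  refine tendsto_integral_of_dominated_convergence
    (fun u => ‖w u * ratio α β u‖ * ((n.factorial * 2 ^ n) ^ k)) (fun N => ?_) ?_
    (fun N => Eventually.of_forall fun u => ?_) (Eventually.of_forall fun u => ?_)
  · exact (integrable_haar (hw.mul ((continuous_det_pow_inv _).mul
      (continuous_det_aeval _)))).aestronglyMeasurable
  · exact (integrable_haar (hw.mul (continuous_ratio hα β))).norm.mul_const _
  · rw [det_approxPoly hα, ← mul_assoc, norm_mul]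
    refine mul_le_mul_of_nonneg_left ?_ (norm_nonneg _)
    rw [norm_prod]
    exact (Finset.prod_le_prod (fun i _ => norm_nonneg _) fun i _ => norm_geomErr_le _ _ _).trans
      (by simp)
  · simp_rw [det_approxPoly hα, ← mul_assoc]
    have h1 : Tendsto (fun N => ∏ i, geomErr (α i) N u) atTop (𝓝 (∏ _i : Fin k, 1)) :=
      tendsto_finsetProd _ fun i _ => tendsto_geomErr (hα i) u
    simpa using (tendsto_const_nhds (x := w u * ratio α β u)).mul h1

theorem det_aeval_U_one (u : U 1) (p : ℂ[X]) : (aeval u.1 p).det = p.eval u.1.det := by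
  have h : u.1 = algebraMap ℂ (Matrix (Fin 1) (Fin 1) ℂ) u.1.det := by
    ext i j
    fin_cases i; fin_cases j
    simp [Matrix.algebraMap_eq_diagonal]
  conv_lhs => rw [h]
  rw [aeval_algebraMap_apply, Matrix.algebraMap_eq_diagonal, Matrix.det_diagonal]
  simp

/-- Heine–Szegő for the symbol b/a: both sides are limits of the identity for the approximating
Laurent polynomials. -/
theorem integral_ratio_eq_det {n : ℕ} {α : Fin k → ℂ} (hα : ∀ i, ‖α i‖ ≠ 1) (β : Fin k → ℂ) :
    ∫ u : U n, ratio α β u ∂haar n = (Matrix.of fun q p : Fin n =>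
      ∫ u : U 1, u.1.det ^ ((p : ℤ) - q) * ratio α β u ∂haar 1).det := by
  have h1 := tendsto_integral_approx (n := n) hα β (w := fun _ => 1) continuous_const
  simp only [one_mul] at h1
  have h2 : Tendsto (fun N => (Matrix.of fun q p : Fin n =>
      ∫ u : U 1, u.1.det ^ ((p : ℤ) - q) * ((u.1.det ^ approxExp α N)⁻¹ *
        (aeval u.1 (approxPoly α β N)).det) ∂haar 1).det) atTop
      (𝓝 (Matrix.of fun q p : Fin n =>
        ∫ u : U 1, u.1.det ^ ((p : ℤ) - q) * ratio α β u ∂haar 1).det) := by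
    refine ((continuous_id.matrix_det).tendsto _).comp ?_
    refine tendsto_pi_nhds.2 fun q => tendsto_pi_nhds.2 fun p => ?_
    exact tendsto_integral_approx hα β (continuous_det_zpow _)
  refine tendsto_nhds_unique h1 (h2.congr' ?_)
  filter_upwards [eventually_ne_atTop 0] with N hN
  obtain ⟨h0, hle⟩ := approxPoly_ne_zero_and_le (α := α) (β := β) hN
  rw [integral_det_aeval h0 hle, toepDet]
  congr 1
  ext q p
  rw [Matrix.of_apply, Matrix.of_apply, ← integral_det_zpow_mul_eval]
  congr 1
  ext u
  rw [det_aeval_U_one, eval_mul, eval_pow, eval_X, sub_eq_add_neg,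
    zpow_add₀ (det_coeU_ne_zero u), Nat.cast_add, neg_add, zpow_add₀ (det_coeU_ne_zero u),
    zpow_natCast, _root_.zpow_neg _ ((approxExp α N : ℕ) : ℤ), zpow_natCast]
  ring

end Approximation

end CUE

/-! ### The ratio formula as a Cauchy-type determinant -/

open MeasureTheory ProbabilityTheory

namespace CUE

open Matrix Polynomial

section RatioFormula

variable {k : ℕ}

theorem eval_prod_X_sub_C_ne_zero {α : Fin k → ℂ} (hα : ∀ i, ‖α i‖ ≠ 1) (u : U 1) :
    (∏ j, (X - C (α j))).eval u.1.det ≠ 0 := by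
  rw [← det_aeval_U_one]
  exact det_aeval_prod_ne_zero hα u

theorem continuous_eval_div {α : Fin k → ℂ} (hα : ∀ i, ‖α i‖ ≠ 1) (q : ℤ) (P : ℂ[X]) :
    Continuous fun u : U 1 =>
      u.1.det ^ q * (P.eval u.1.det / (∏ j, (X - C (α j))).eval u.1.det) :=
  (continuous_det_zpow q).mul ((P.continuous.comp continuous_coeU.matrix_det).div
    ((∏ j, (X - C (α j))).continuous.comp continuous_coeU.matrix_det)
      (eval_prod_X_sub_C_ne_zero hα))

/-- The functional sending `P` to the Fourier coefficient of index `q` of `P / ∏ (X - α_j)` on the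
unit circle. -/
noncomputable def fourierFunctional (α : Fin k → ℂ) (hα : ∀ i, ‖α i‖ ≠ 1) (q : ℕ) : ℂ[X] →ₗ[ℂ] ℂ where
  toFun P := ∫ u : U 1, u.1.det ^ (-(q : ℤ)) *
    (P.eval u.1.det / (∏ j, (X - C (α j))).eval u.1.det) ∂haar 1
  map_add' P Q := by
    rw [← integral_add (integrable_haar (continuous_eval_div hα _ P))
      (integrable_haar (continuous_eval_div hα _ Q))]
    congr 1
    ext u
    rw [eval_add]; ring
  map_smul' c P := by
    rw [RingHom.id_apply, smul_eq_mul, ← integral_const_mul]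
    congr 1
    ext u
    rw [eval_smul, smul_eq_mul]; ring

/-- The product of `X - α_j` over `j ≠ c`. -/
noncomputable def prodErase (α : Fin k → ℂ) (c : Fin k) : ℂ[X] :=
  ∏ j ∈ Finset.univ.erase c, (X - C (α j))

theorem mul_prodErase (α : Fin k → ℂ) (c : Fin k) :
    (X - C (α c)) * prodErase α c = ∏ j, (X - C (α j)) := by
  rw [prodErase]
  exact Finset.mul_prod_erase Finset.univ (fun j => X - C (α j)) (Finset.mem_univ c)

theorem degree_prodErase_lt (α : Fin k → ℂ) (c : Fin k) : (prodErase α c).degree < k := by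
  have hm : (prodErase α c).Monic := monic_prod_of_monic _ _ fun j _ => monic_X_sub_C _
  rw [degree_eq_natDegree hm.ne_zero, prodErase,
    natDegree_prod_of_monic _ _ fun j _ => monic_X_sub_C _]
  simpa using c.pos

theorem fourierFunctional_prodErase {α : Fin k → ℂ} (hα : ∀ i, ‖α i‖ ≠ 1) (q : ℕ) (c : Fin k) :
    fourierFunctional α hα q (prodErase α c) = circInt (α c) (-(q : ℤ)) := by
  change ∫ u : U 1, _ ∂haar 1 = ∫ u : U 1, _ ∂haar 1
  congr 1
  ext u
  have h := eval_prod_X_sub_C_ne_zero hα u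
  rw [← mul_prodErase α c, eval_mul] at h
  rw [← mul_prodErase α c, eval_mul]
  have h1 := left_ne_zero_of_mul h
  have h2 := right_ne_zero_of_mul h
  simp only [eval_sub, eval_X, eval_C] at h1 ⊢
  field_simp

theorem fourierFunctional_X_pow_mul {α : Fin k → ℂ} (hα : ∀ i, ‖α i‖ ≠ 1) (q p : ℕ) :
    fourierFunctional α hα q (X ^ p * ∏ j, (X - C (α j))) = if q = p then 1 else 0 := by
  have h : fourierFunctional α hα q (X ^ p * ∏ j, (X - C (α j)))
      = ∫ u : U 1, u.1.det ^ (-(q : ℤ)) * (X ^ p : ℂ[X]).eval u.1.det ∂haar 1 := by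
    change ∫ u : U 1, _ ∂haar 1 = ∫ u : U 1, _ ∂haar 1
    congr 1
    ext u
    rw [eval_mul, mul_div_cancel_right₀ _ (eval_prod_X_sub_C_ne_zero hα u)]
  rw [h, integral_det_zpow_mul_eval, coeff_X_pow]

theorem fourierFunctional_X_pow_mul_prod {α : Fin k → ℂ} (hα : ∀ i, ‖α i‖ ≠ 1) (β : Fin k → ℂ)
    (q p : ℕ) : fourierFunctional α hα q (X ^ p * ∏ j, (X - C (β j)))
      = ∫ u : U 1, u.1.det ^ ((p : ℤ) - q) * ratio α β u ∂haar 1 := by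
  change ∫ u : U 1, _ ∂haar 1 = ∫ u : U 1, _ ∂haar 1
  congr 1
  ext u
  rw [ratio, det_aeval_U_one, det_aeval_U_one, eval_mul, eval_pow, eval_X, sub_eq_add_neg,
    zpow_add₀ (det_coeU_ne_zero u), zpow_natCast]
  ring

/-- This is the entry of the Schur complement. For |α| < 1 the circle integrals vanish; for |α| > 1
they form a finite geometric series in β/α, whose sum leaves only the term (β/α)^n. -/
theorem sub_sum_circInt {n : ℕ} {α β : ℂ} (hα : ‖α‖ ≠ 1) (hne : β ≠ α) :
    1 / (β - α) - ∑ p : Fin n, β ^ (p : ℕ) * circInt α (-((p : ℕ) : ℤ))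
      = (if ‖α‖ < 1 then 1 else (β / α) ^ n) / (β - α) := by
  have h0 : β - α ≠ 0 := sub_ne_zero.2 hne
  split_ifs with h
  · simp_rw [circInt_neg_of_norm_lt h]
    simp
  · have h1 : 1 < ‖α‖ := lt_of_le_of_ne (not_lt.1 h) hα.symm
    have hα0 : α ≠ 0 := by rintro rfl; simp at h
    simp_rw [circInt_neg_of_lt_norm h1]
    have h2 : ∑ p : Fin n, β ^ (p : ℕ) * -α⁻¹ ^ ((p : ℕ) + 1)
        = -α⁻¹ * ∑ p ∈ Finset.range n, (β / α) ^ p := by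
      rw [Finset.mul_sum, ← Fin.sum_univ_eq_sum_range fun p => -α⁻¹ * (β / α) ^ p]
      refine Finset.sum_congr rfl fun p _ => ?_
      rw [div_eq_mul_inv, mul_pow, pow_succ]; ring
    have h3 : β / α ≠ 1 := by
      intro h; rw [div_eq_one_iff_eq hα0] at h; exact hne h
    have h4 : β / α - 1 ≠ 0 := sub_ne_zero.2 h3
    have h5 : β / α - 1 = (β - α) / α := by field_simp
    rw [h2, geom_sum_eq h3, h5]
    field_simp
    ring

/-- The determinant of evaluations at β_j and Fourier functionals on monomials is computed from two
bases, one built on b and one on a. In the second, the lower right block is the identity, so the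
determinant is that of a Schur complement. -/
theorem cauchy_det_mul_integral_ratio {n : ℕ} {α β : Fin k → ℂ} (hα : ∀ i, ‖α i‖ ≠ 1)
    (hne : ∀ i j, β j ≠ α i) :
    (Matrix.of fun j c : Fin k => 1 / (β j - α c)).det * ∫ u : U n, ratio α β u ∂haar n
      = (Matrix.of fun j c : Fin k =>
          (if ‖α c‖ < 1 then 1 else (β j / α c) ^ n) / (β j - α c)).det := by
  set a : ℂ[X] := ∏ j, (X - C (α j)) with ha
  have ham : a.Monic := monic_prod_of_monic _ _ fun j _ => monic_X_sub_C _
  have had : a.natDegree = k := by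
    rw [ha, natDegree_prod_of_monic _ _ fun j _ => monic_X_sub_C _]; simp
  set μ : Fin n → ℂ[X] →ₗ[ℂ] ℂ := fun q => fourierFunctional α hα q with hμ
  set D := (Matrix.of fun c' c : Fin k => (prodErase α c).coeff c').det with hD
  have haβ : ∀ j, a.eval (β j) ≠ 0 := by
    intro j
    rw [ha, eval_prod]
    exact Finset.prod_ne_zero_iff.2 fun i _ => by simpa using sub_ne_zero.2 (hne i j)
  have hQ : ∀ j c, (prodErase α c).eval (β j) = a.eval (β j) * (1 / (β j - α c)) := by
    intro j c
    have h0 : β j - α c ≠ 0 := sub_ne_zero.2 (hne c j)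
    rw [ha, ← mul_prodErase α c, eval_mul, eval_sub, eval_X, eval_C]
    field_simp
  have hL := det_functionals_eq (evalFunctionals β μ) ham had (prodErase α) (degree_prodErase_lt α)
  have hblock : (Matrix.of fun i x => evalFunctionals β μ i
      (Sum.elim (prodErase α) (fun p : Fin n => X ^ (p : ℕ) * a) x))
      = Matrix.fromBlocks (Matrix.of fun j c : Fin k => (prodErase α c).eval (β j))
        (Matrix.of fun (j : Fin k) (p : Fin n) => β j ^ (p : ℕ) * a.eval (β j))
        (Matrix.of fun (q : Fin n) (c : Fin k) => circInt (α c) (-((q : ℕ) : ℤ))) 1 := by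
    ext1 i x
    rcases i with i | i <;> rcases x with x | x <;>
      simp only [Matrix.of_apply, evalFunctionals, Sum.elim_inl, Sum.elim_inr, hμ, ha,
        Matrix.fromBlocks_apply₁₁, Matrix.fromBlocks_apply₁₂, Matrix.fromBlocks_apply₂₁,
        Matrix.fromBlocks_apply₂₂, leval_apply, eval_mul, eval_pow, eval_X,
        fourierFunctional_prodErase, fourierFunctional_X_pow_mul, Matrix.one_apply]
    simp [Fin.ext_iff]
  rw [hblock, Matrix.det_fromBlocks_one₂₂] at hL
  have hentry : (Matrix.of fun j c : Fin k => (prodErase α c).eval (β j))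
      - (Matrix.of fun (j : Fin k) (p : Fin n) => β j ^ (p : ℕ) * a.eval (β j))
        * (Matrix.of fun (q : Fin n) (c : Fin k) => circInt (α c) (-((q : ℕ) : ℤ)))
      = Matrix.of fun j c : Fin k => a.eval (β j) * (Matrix.of fun j c : Fin k =>
          (if ‖α c‖ < 1 then 1 else (β j / α c) ^ n) / (β j - α c)) j c := by
    ext j c
    rw [Matrix.sub_apply, Matrix.mul_apply]
    simp only [Matrix.of_apply]
    rw [hQ, ← sub_sum_circInt (hα c) (hne c j), mul_sub, Finset.mul_sum]
    congr 1
    exact Finset.sum_congr rfl fun p _ => by ring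
  rw [hentry, Matrix.det_mul_column] at hL
  have hV := vandermonde_mul_det_functionals β μ
  have hT : (Matrix.of fun q p : Fin n => μ q (X ^ (p : ℕ) * ∏ j, (X - C (β j)))).det
      = ∫ u : U n, ratio α β u ∂haar n := by
    rw [integral_ratio_eq_det hα β]
    congr 1
    ext q p
    exact fourierFunctional_X_pow_mul_prod hα β q p
  -- The polynomials a/(X - α_c) evaluated at β_j give the Cauchy matrix with rows scaled by a(β_j);
  -- expanding them in monomials gives Vandermonde times the transition determinant D.
  have hC : (∏ j, a.eval (β j)) * (Matrix.of fun j c : Fin k => 1 / (β j - α c)).det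
      = (Matrix.vandermonde β).det * D := by
    rw [← Matrix.det_mul_column, hD, ← Matrix.det_mul]
    congr 1
    ext j c
    rw [Matrix.mul_apply]
    simp only [Matrix.of_apply, Matrix.vandermonde_apply]
    rw [← hQ]
    have hdeg : (prodErase α c).natDegree < k := by
      have hm : (prodErase α c).Monic := monic_prod_of_monic _ _ fun j _ => monic_X_sub_C _
      exact (natDegree_lt_iff_degree_lt hm.ne_zero).2 (degree_prodErase_lt α c)
    rw [eval_eq_sum_range' hdeg,
      ← Fin.sum_univ_eq_sum_range fun i => (prodErase α c).coeff i * β j ^ i]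
    exact Finset.sum_congr rfl fun i _ => mul_comm _ _
  have hprod : (∏ j, a.eval (β j)) ≠ 0 := Finset.prod_ne_zero_iff.2 fun j _ => haβ j
  apply mul_left_cancel₀ hprod
  rw [hL, ← mul_assoc, hC, ← hV, hT]
  ring

theorem integral_ratio_single {n : ℕ} {α : ℂ} (β : ℂ) (hα : ‖α‖ ≠ 1) :
    ∫ u : U n, ratio (fun _ : Fin 1 => α) (fun _ => β) u ∂haar n
      = if ‖α‖ < 1 then 1 else (β / α) ^ n := by
  -- The Cauchy kernel excludes β = α, where the ratio is identically 1.
  by_cases hne : β = α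
  · subst hne
    have h : ∀ u : U n, ratio (fun _ : Fin 1 => β) (fun _ => β) u = 1 := fun u =>
      div_self (det_aeval_prod_ne_zero (fun _ => hα) u)
    simp_rw [h]
    split_ifs with h1
    · simp
    · have : β ≠ 0 := by rintro rfl; simp at h1
      simp [div_self this]
  · have h := cauchy_det_mul_integral_ratio (n := n) (α := fun _ : Fin 1 => α) (β := fun _ => β)
      (fun _ => hα) fun _ _ => hne
    have h0 : β - α ≠ 0 := sub_ne_zero.2 hne
    rw [Matrix.det_unique, Matrix.det_unique] at h
    simp only [Matrix.of_apply] at h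
    field_simp at h
    exact h

end RatioFormula

/-! ### Back to Z and ξ -/

theorem Z_eq {n : ℕ} (u : U n) (x : ℂ) : Z u x = (u.1.det)⁻¹ * (aeval u.1 (X - C x)).det := by
  have h : (aeval u.1 (X - C x)) = u.1 * (1 - x • ((u⁻¹ : U n) : Matrix (Fin n) (Fin n) ℂ)) := by
    rw [aeval_X_sub_C, mul_sub, mul_one, mul_smul_comm, ← Matrix.UnitaryGroup.mul_val,
      mul_inv_cancel, Matrix.UnitaryGroup.one_val]
  rw [h, Matrix.det_mul, ← mul_assoc, inv_mul_cancel₀ (det_coeU_ne_zero u), one_mul, Z]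

theorem prod_Z_div_eq_ratio {n k : ℕ} (u : U n) (α β : Fin k → ℂ) :
    ∏ j, Z u (β j) / Z u (α j) = ratio α β u := by
  rw [ratio, det_aeval_prod, det_aeval_prod, ← Finset.prod_div_distrib]
  refine Finset.prod_congr rfl fun j _ => ?_
  rw [Z_eq, Z_eq, mul_div_mul_left _ _ (inv_ne_zero (det_coeU_ne_zero u))]

theorem Z_one_ne_zero_ae (n : ℕ) : ∀ᵐ u ∂haar n, Z u 1 ≠ 0 := by
  have h := haar_det_sub_eq_zero (n := n)
  filter_upwards [measure_eq_zero_iff_ae_notMem.1 h] with u hu h0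
  apply hu
  rw [Z_eq, mul_eq_zero, or_iff_right (inv_ne_zero (det_coeU_ne_zero u)), aeval_X_sub_C, one_smul,
    ← neg_sub, Matrix.det_neg, mul_eq_zero, or_iff_right (pow_ne_zero _ (by norm_num))] at h0
  exact h0

/-- The point of the exponential scale attached to `z`. -/
noncomputable def expPt (n : ℕ) (z : ℂ) : ℂ := Complex.exp (2 * Complex.I * Real.pi * z / n)

theorem norm_expPt (n : ℕ) (z : ℂ) : ‖expPt n z‖ = Real.exp (-(2 * Real.pi * z.im / n)) := by
  rw [expPt, Complex.norm_exp]
  congr 1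
  rw [show 2 * Complex.I * Real.pi * z / n
    = ((2 * Real.pi / n : ℝ) : ℂ) * (Complex.I * z) by push_cast; ring, Complex.re_ofReal_mul]
  simp
  ring

theorem norm_expPt_lt_one_iff {n : ℕ} (hn : 1 ≤ n) (z : ℂ) : ‖expPt n z‖ < 1 ↔ 0 < z.im := by
  have hn' : (0 : ℝ) < n := by exact_mod_cast hn
  rw [norm_expPt, Real.exp_lt_one_iff, neg_lt_zero, div_pos_iff_of_pos_right hn',
    mul_pos_iff_of_pos_left (by positivity)]

theorem norm_expPt_ne_one {n : ℕ} (hn : 1 ≤ n) {z : ℂ} (hz : z.im ≠ 0) : ‖expPt n z‖ ≠ 1 := by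
  have hn' : (n : ℝ) ≠ 0 := by positivity
  rw [norm_expPt, Ne, Real.exp_eq_one_iff]
  simp [hz, hn', Real.pi_ne_zero]

theorem expPt_div_pow {n : ℕ} (hn : 1 ≤ n) (z z' : ℂ) :
    (expPt n z' / expPt n z) ^ n = Complex.exp (2 * Complex.I * Real.pi * (z' - z)) := by
  have hn' : (n : ℂ) ≠ 0 := by exact_mod_cast (by omega : n ≠ 0)
  rw [expPt, expPt, ← Complex.exp_sub, ← Complex.exp_nat_mul]
  congr 1
  field_simp

theorem expPt_ne {n : ℕ} (hn : 1 ≤ n) {z z' : ℂ} (h : ∀ m : ℤ, z - z' ≠ (m : ℂ) * (n : ℂ)) :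
    expPt n z' ≠ expPt n z := by
  have hn' : (n : ℂ) ≠ 0 := by exact_mod_cast (by omega : n ≠ 0)
  intro he
  obtain ⟨m, hm⟩ := Complex.exp_eq_exp_iff_exists_int.1 he.symm
  refine h m ?_
  have hπ : (Real.pi : ℂ) ≠ 0 := by exact_mod_cast Real.pi_ne_zero
  have hI := Complex.I_ne_zero
  have h2 : (2 * Complex.I * Real.pi) * (z - z') = (2 * Complex.I * Real.pi) * (m * n) := by
    field_simp at hm
    linear_combination (2 * Complex.I * Real.pi) * hm
  exact mul_left_cancel₀ (by simp [hπ]) h2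

/-- Off the null event Z(1) = 0 the common denominators cancel, and the law of `Un` transports the
integral to the Haar measure. -/
theorem integral_xi {Ω : Type*} [MeasurableSpace Ω] {P : Measure Ω} {n k : ℕ} (hn : 1 ≤ n)
    {Un : Ω → U n} (hUn : HasLaw Un (haar n) P) (z z' : Fin k → ℂ) (hz : ∀ i, (z i).im ≠ 0) :
    Integrable (fun ω => ∏ j, xi (Un ω) (z' j) / xi (Un ω) (z j)) P ∧
    ∫ ω, ∏ j, xi (Un ω) (z' j) / xi (Un ω) (z j) ∂P
      = ∫ u : U n, ratio (fun i => expPt n (z i)) (fun j => expPt n (z' j)) u ∂haar n := by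
  set R : U n → ℂ := ratio (fun i => expPt n (z i)) (fun j => expPt n (z' j)) with hR
  have hRc : Continuous R := continuous_ratio (fun i => norm_expPt_ne_one hn (hz i)) _
  have hae : (fun ω => ∏ j, xi (Un ω) (z' j) / xi (Un ω) (z j)) =ᵐ[P] fun ω => R (Un ω) := by
    have h1 := Z_one_ne_zero_ae n
    rw [← hUn.map_eq] at h1
    filter_upwards [ae_of_ae_map hUn.aemeasurable h1] with ω hω
    rw [hR, ← prod_Z_div_eq_ratio]
    exact Finset.prod_congr rfl fun j _ => div_div_div_cancel_right₀ hω _ _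
  have hi : Integrable (fun ω => R (Un ω)) P := by
    have h2 : Integrable R (P.map Un) := by rw [hUn.map_eq]; exact integrable_haar hRc
    exact h2.comp_aemeasurable hUn.aemeasurable
  refine ⟨hi.congr hae.symm, ?_⟩
  rw [integral_congr_ae hae]
  exact hUn.integral_comp hRc.aestronglyMeasurable

theorem integral_xi_single {Ω : Type*} [MeasurableSpace Ω] {P : Measure Ω} {n : ℕ} (hn : 1 ≤ n)
    {Un : Ω → U n} (hUn : HasLaw Un (haar n) P) {z : ℂ} (z' : ℂ) (hz : z.im ≠ 0) :
    Integrable (fun ω => xi (Un ω) z' / xi (Un ω) z) P ∧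
    ∫ ω, xi (Un ω) z' / xi (Un ω) z ∂P
      = if ‖expPt n z‖ < 1 then 1 else (expPt n z' / expPt n z) ^ n := by
  have h := integral_xi hn hUn (fun _ : Fin 1 => z) (fun _ => z') fun _ => hz
  rw [integral_ratio_single _ (norm_expPt_ne_one hn hz)] at h
  simpa using h

end CUE

theorem mainTheorem6 {Ω : Type*} [MeasurableSpace Ω] (P : Measure Ω) [IsProbabilityMeasure P]
    (n : ℕ) (hn : 1 ≤ n) (Un : Ω → CUE.U n) (hUn : HasLaw Un (CUE.haar n) P) :
    (∀ (k : ℕ) (z z' : Fin k → ℂ), (∀ i, (z i).im ≠ 0) →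
      (∀ i j, ∀ m : ℤ, z i - z' j ≠ (m : ℂ) * (n : ℂ)) →
      Integrable (fun ω => ∏ j, CUE.xi (Un ω) (z' j) / CUE.xi (Un ω) (z j)) P ∧
      Matrix.det (Matrix.of fun i j : Fin k =>
          1 / (Complex.exp (2 * Complex.I * Real.pi * z i / n) -
            Complex.exp (2 * Complex.I * Real.pi * z' j / n))) *
        (∫ ω, ∏ j, CUE.xi (Un ω) (z' j) / CUE.xi (Un ω) (z j) ∂P) =
      Matrix.det (Matrix.of fun i j : Fin k =>
          1 / (Complex.exp (2 * Complex.I * Real.pi * z i / n) -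
            Complex.exp (2 * Complex.I * Real.pi * z' j / n)) *
          ∫ ω, CUE.xi (Un ω) (z' j) / CUE.xi (Un ω) (z i) ∂P)) ∧
    (∀ z z' : ℂ, z.im ≠ 0 →
      Integrable (fun ω => CUE.xi (Un ω) z' / CUE.xi (Un ω) z) P ∧
      (0 < z.im → ∫ ω, CUE.xi (Un ω) z' / CUE.xi (Un ω) z ∂P = 1) ∧
      (z.im < 0 → ∫ ω, CUE.xi (Un ω) z' / CUE.xi (Un ω) z ∂P =
        Complex.exp (2 * Complex.I * Real.pi * (z' - z)))) := by
  refine ⟨fun k z z' hz hzz => ?_, fun z z' hz => ?_⟩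
  · obtain ⟨h1, h2⟩ := CUE.integral_xi hn hUn z z' hz
    refine ⟨h1, ?_⟩
    rw [h2]
    have h3 := CUE.cauchy_det_mul_integral_ratio (n := n) (α := fun i => CUE.expPt n (z i))
      (β := fun j => CUE.expPt n (z' j)) (fun i => CUE.norm_expPt_ne_one hn (hz i))
      fun i j => CUE.expPt_ne hn (hzz i j)
    -- The denominators here are α_i - β_j, and the ratio formula uses β_j - α_c with rows indexed
    -- by β: a transpose and a sign, the same on both sides.
    have e1 : (Matrix.of fun i j : Fin k =>
          1 / (Complex.exp (2 * Complex.I * Real.pi * z i / n) -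
            Complex.exp (2 * Complex.I * Real.pi * z' j / n)))
        = -(Matrix.of fun j c : Fin k =>
          1 / (CUE.expPt n (z' j) - CUE.expPt n (z c))).transpose := by
      ext i j
      simp only [Matrix.neg_apply, Matrix.transpose_apply, Matrix.of_apply, CUE.expPt]
      rw [← div_neg, neg_sub]
    have e2 : (Matrix.of fun i j : Fin k =>
          1 / (Complex.exp (2 * Complex.I * Real.pi * z i / n) -
            Complex.exp (2 * Complex.I * Real.pi * z' j / n)) *
          ∫ ω, CUE.xi (Un ω) (z' j) / CUE.xi (Un ω) (z i) ∂P)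
        = -(Matrix.of fun j c : Fin k =>
          (if ‖CUE.expPt n (z c)‖ < 1 then 1 else (CUE.expPt n (z' j) / CUE.expPt n (z c)) ^ n) /
            (CUE.expPt n (z' j) - CUE.expPt n (z c))).transpose := by
      ext i j
      simp only [Matrix.neg_apply, Matrix.transpose_apply, Matrix.of_apply]
      rw [(CUE.integral_xi_single hn hUn (z' j) (hz i)).2, ← div_neg, neg_sub, one_div_mul_eq_div]
      rfl
    rw [e1, e2, Matrix.det_neg, Matrix.det_neg, Matrix.det_transpose, Matrix.det_transpose,
      mul_assoc, h3]
  · obtain ⟨h1, h2⟩ := CUE.integral_xi_single hn hUn z' hz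
    refine ⟨h1, fun hpos => ?_, fun hneg => ?_⟩
    · rw [h2, if_pos ((CUE.norm_expPt_lt_one_iff hn z).2 hpos)]
    · rw [h2, if_neg fun h => lt_asymm hneg ((CUE.norm_expPt_lt_one_iff hn z).1 h),
        CUE.expPt_div_pow hn]
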